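/- Let $\lambda,k_1,k_2$ be real constants with $\lambda\neq0$, $k_2\neq 0$, let $$S=\frac{u_{3x}}{u_x}-\frac32\frac{u_{xx}^2}{u_x^2}$$ be the Schwarzian derivative, and consider the fully nonlinear third-order evolution equation $$u_t=K:=\lambda\frac{u_x}{\sqrt S}\qquad(u_x\neq0,\ S>0).$$ A differential function is a smooth function of $x,t,u$ and finitely many $x$-derivatives of $u$ on the domain $u_x\ne0$, $S>0$; $D_x$ is the total $x$-derivative, and subscripts on $S$ denote total $x$-derivatives. For an evolution equation $u_t=E$ put $L_EQ=D_tQ-\sum_k\frac{\partial E}{\partial u_{kx}}D_x^kQ$, where $D_t$ is the total $t$-derivative along solutions; a (Lie–Bäcklund) symmetry of the equation is a differential function $Q$ with $L_EQ=0$. Let $$R[u]=G_2D_x^2+G_1D_x+G_0+\lambda\frac{u_x}{\sqrt S}\,D_x^{-1}\circ\Lambda,$$ $$G_0=\frac{k_2}{4}\left(\frac{S_{xx}}{S^2}+\frac{u_{xx}}{u_x}\frac{S_x}{S^2}-\frac32\frac{S_x^2}{S^3}-\frac{u_{xx}^2}{u_x^2}\frac1S\right)+k_1+k_2,$$ $$G_1=k_2\left(\frac{u_{xx}}{u_x}\frac1S-\frac14\frac{S_x}{S^2}\right),\qquad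 G_2=-\frac{k_2}{2S},$$ $$\Lambda=-\frac{k_2}{4\lambda u_x}\left(\frac{S_{3x}}{S^{3/2}}-\frac92\frac{S_xS_{xx}}{S^{5/2}}+\frac{15}4\frac{S_x^3}{S^{7/2}}\right).$$ Here $R[u]Q$ is defined for those differential functions $Q$ for which there is a differential function $D_x^{-1}(\Lambda Q)$ whose total $x$-derivative is $\Lambda Q$. $R[u]$ is called a recursion operator of $u_t=E$ if $L_E$ and $R[u]$ commute, i.e. for every such $Q$ and every value of $D_x^{-1}(\Lambda Q)$ there is a value of $D_x^{-1}(\Lambda L_EQ)$ with $L_E(R[u]Q)=R[u](L_EQ)$, and if for every symmetry $Q$ of $u_t=E$ for which $D_x^{-1}(\Lambda Q)$ exists, $R[u]Q$ is a symmetry for a suitable choice of this antiderivative. Then: 1. $R[u]$ is a recursion operator of $u_t=\lambda u_xS^{-1/2}$. 2. The hierarchy $u_{t_j}=Q_j:=R^j[u]\,u_t$, $j=0,1,2,\dots$, that is $Q_0=K$, $Q_{j+1}=R[u]Q_j$, where $D_x^{-1}(\Lambda Q_j)$ is taken with zero integration constant (it vanishes wherever $S_x=S_{xx}=\dots=0$),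 is well defined: at every step this antiderivative exists as a differential function, and the $Q_j$ are unique. 3. The hierarchy is symmetry-integrable: $Q_j$ has order $2j+3$, with $\partial Q_j/\partial u_{(2j+3)x}$ nowhere zero; every $Q_j$ is a symmetry of every member $u_{t_i}=Q_i$ ($i,j\ge 0$); and $R[u]$ is a recursion operator of every member. 4. Every member is of the form $u_{t_j}=u_x\Psi_j(S,S_x,S_{xx},\dots,S_{nx})$ with a smooth function $\Psi_j$ and $n=2j$. 5. The fifth-order member is $$u_{t_1}=\lambda u_x\left[\frac{k_2}{4}\frac{S_{xx}}{S^{5/2}}-\frac{5k_2}{16}\frac{S_x^2}{S^{7/2}}+\left(\frac{k_2}{2}+k_1\right)\frac1{S^{1/2}}\right],$$ and for $k_2=1$ the seventh-order member is $$u_{t_2}=\lambda u_x\Big[-\frac18\frac{S_{4x}}{S^{7/2}}+\frac78\frac{S_xS_{3x}}{S^{9/2}}+\frac{21}{32}\frac{S_{xx}^2}{S^{9/2}}-\frac{231}{64}\frac{S_x^2S_{xx}}{S^{11/2}}+\frac14(2k_1+1)\frac{S_{xx}}{S^{5/2}}+\frac{1155}{512}\frac{S_x^4}{S^{13/2}}-\frac5{16}(2k_1+1)\frac{S_x^2}{S^{7/2}}+\frac14(2k_1+1)^2\frac1{S^{1/2}}\Big].$$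 -/

import Mathlib

open scoped ContDiff

noncomputable section

namespace SchwarzianFlow

/-- A point of the infinite jet space over `(x, t)`, with `t`-derivatives of `u` eliminated:
`u k` is the coordinate `u_{kx}` (so `u 0 = u`, `u 1 = u_x`, `u 2 = u_{xx}`, ...). -/
structure Jet where
  x : ℝ
  t : ℝ
  u : ℕ → ℝ

/-- The Schwarzian derivative `S = u_{3x}/u_x - (3/2) u_{xx}^2/u_x^2`. -/
def S (a : Jet) : ℝ := a.u 3 / a.u 1 - 3 / 2 * (a.u 2 ^ 2 / a.u 1 ^ 2)

/-- The set of jets on which the equation `u_t = λ u_x S^{-1/2}` makes sense over the reals. -/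
def dom : Set Jet := {a | a.u 1 ≠ 0 ∧ 0 < S a}

/-- The coordinates `(x, t, u, u_x, ..., u_{nx})` of a jet. -/
def trunc (n : ℕ) (a : Jet) : ℝ × ℝ × (Fin (n + 1) → ℝ) := (a.x, a.t, fun i => a.u i)

/-- `F` is, on `dom`, a smooth function of `x, t, u, u_x, ..., u_{nx}`. -/
def HasOrderLE (n : ℕ) (F : Jet → ℝ) : Prop :=
  ∃ f : ℝ × ℝ × (Fin (n + 1) → ℝ) → ℝ,
    ContDiffOn ℝ ∞ f (trunc n '' dom) ∧ ∀ a ∈ dom, F a = f (trunc n a)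

/-- Differential functions: smooth functions of `x`, `t`, `u` and finitely many `x`-derivatives of
`u`, defined on `dom` (values outside `dom` are irrelevant). -/
def IsDiffFun (F : Jet → ℝ) : Prop := ∃ n, HasOrderLE n F

/-- `∂F/∂x` (explicit dependence). -/
def partialX (F : Jet → ℝ) (a : Jet) : ℝ := deriv (fun y => F { a with x := y }) a.x

/-- `∂F/∂t` (explicit dependence). -/
def partialT (F : Jet → ℝ) (a : Jet) : ℝ := deriv (fun y => F { a with t := y }) a.t

/-- `∂F/∂u_{kx}`. -/
def partialU (k : ℕ) (F : Jet → ℝ) (a : Jet) : ℝ :=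
  deriv (fun y => F { a with u := Function.update a.u k y }) (a.u k)

/-- `F` is a differential function of order exactly `n`, and `∂F/∂u_{nx}` vanishes nowhere. -/
def HasOrder (n : ℕ) (F : Jet → ℝ) : Prop :=
  HasOrderLE n F ∧ ∀ a ∈ dom, partialU n F a ≠ 0

/-- The total derivative `D_x = ∂/∂x + ∑ u_{(k+1)x} ∂/∂u_{kx}`; for a differential function
the sum is finite. -/
def Dx (F : Jet → ℝ) (a : Jet) : ℝ :=
  partialX F a + ∑ᶠ k : ℕ, a.u (k + 1) * partialU k F a

/-- The linearization (Fréchet derivative) of `F`: the operator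
`∑ (∂F/∂u_{kx}) D_x^k`, applied to `V`. -/
def frechet (F V : Jet → ℝ) (a : Jet) : ℝ := ∑ᶠ k : ℕ, partialU k F a * (Dx^[k] V) a

/-- The total `t`-derivative of `F` along solutions of `u_t = E`. -/
def Dt (E F : Jet → ℝ) (a : Jet) : ℝ := partialT F a + frechet F E a

/-- The linearized equation operator of `u_t = E` on solutions: `Q ↦ D_t Q - ∑ (∂E/∂u_{kx}) D_x^k Q`. -/
def linOp (E Q : Jet → ℝ) (a : Jet) : ℝ := Dt E Q a - frechet E Q a

/-- `Q` is the characteristic of a generalised (Lie-Bäcklund) symmetry `Q ∂/∂u` of the evolution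
equation `u_t = E`. -/
def IsSymmetry (E Q : Jet → ℝ) : Prop := IsDiffFun Q ∧ ∀ a ∈ dom, linOp E Q a = 0

/-- `S_{kx}`, the `k`-th total `x`-derivative of the Schwarzian derivative. -/
def Sx (k : ℕ) : Jet → ℝ := Dx^[k] S

/-- The right-hand side `λ u_x S^{-1/2}` of the third-order equation. -/
def K (lam : ℝ) (a : Jet) : ℝ := lam * (a.u 1 / √(S a))

/-- Coefficient `G_0` of the recursion operator. -/
def G0 (k1 k2 : ℝ) (a : Jet) : ℝ :=
  k2 / 4 * (Sx 2 a / S a ^ 2 + a.u 2 / a.u 1 * (Sx 1 a / S a ^ 2)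
    - 3 / 2 * (Sx 1 a ^ 2 / S a ^ 3) - a.u 2 ^ 2 / a.u 1 ^ 2 * (1 / S a)) + k1 + k2

/-- Coefficient `G_1` of the recursion operator. -/
def G1 (k2 : ℝ) (a : Jet) : ℝ :=
  k2 * (a.u 2 / a.u 1 * (1 / S a) - 1 / 4 * (Sx 1 a / S a ^ 2))

/-- Coefficient `G_2` of the recursion operator. -/
def G2 (k2 : ℝ) (a : Jet) : ℝ := -(k2 / (2 * S a))

/-- The factor `Λ` of the nonlocal part of the recursion operator. -/
def Lam (lam k2 : ℝ) (a : Jet) : ℝ :=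
  -(k2 / (4 * lam * a.u 1)) *
    (Sx 3 a / √(S a) ^ 3 - 9 / 2 * (Sx 1 a * Sx 2 a / √(S a) ^ 5)
      + 15 / 4 * (Sx 1 a ^ 3 / √(S a) ^ 7))

/-- `P` is a value of `D_x^{-1} (Λ Q)`, i.e. a differential function with `D_x P = Λ Q`. -/
def IsPotential (lam k2 : ℝ) (Q P : Jet → ℝ) : Prop :=
  IsDiffFun P ∧ ∀ a ∈ dom, Dx P a = Lam lam k2 a * Q a

/-- `R[u] Q = G_2 D_x^2 Q + G_1 D_x Q + G_0 Q + λ u_x S^{-1/2} P`, where `P` stands for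
the chosen value of `D_x^{-1} (Λ Q)`. -/
def R (lam k1 k2 : ℝ) (Q P : Jet → ℝ) (a : Jet) : ℝ :=
  G2 k2 a * Dx (Dx Q) a + G1 k2 a * Dx Q a + G0 k1 k2 a * Q a + K lam a * P a

/-- `R[u]` is a recursion operator of the evolution equation `u_t = E`:
* it commutes with the linearized equation operator `L` of `u_t = E`, that is `L (R Q) = R (L Q)` for
  every `Q` on which `R` is defined;
* it maps symmetries to symmetries: if `Q` is a symmetry and `D_x^{-1} (Λ Q)` exists, then `R Q`
  is a symmetry for a suitable choice of the integration constant (a function of `t`). -/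
def IsRecursionOperator (lam k1 k2 : ℝ) (E : Jet → ℝ) : Prop :=
  (∀ Q P : Jet → ℝ, IsDiffFun Q → IsPotential lam k2 Q P →
    ∃ P' : Jet → ℝ, IsPotential lam k2 (linOp E Q) P' ∧
      ∀ a ∈ dom, linOp E (R lam k1 k2 Q P) a = R lam k1 k2 (linOp E Q) P' a) ∧
  (∀ Q P : Jet → ℝ, IsSymmetry E Q → IsPotential lam k2 Q P →
    ∃ P' : Jet → ℝ, IsPotential lam k2 Q P' ∧ IsSymmetry E (R lam k1 k2 Q P'))

/-- `Q j = R^j[u] u_t` for all `j`, where `u_t = λ u_x S^{-1/2}` and every `D_x^{-1}` is taken with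
integration constant zero: the potential vanishes at the jets with `S_x = S_{xx} = ... = 0`. -/
def IsHierarchy (lam k1 k2 : ℝ) (Q : ℕ → Jet → ℝ) : Prop :=
  (∀ a ∈ dom, Q 0 a = K lam a) ∧
  ∀ j, IsDiffFun (Q j) ∧ ∃ P : Jet → ℝ, IsPotential lam k2 (Q j) P ∧
    (∀ a ∈ dom, (∀ k, 1 ≤ k → Sx k a = 0) → P a = 0) ∧
    ∀ a ∈ dom, Q (j + 1) a = R lam k1 k2 (Q j) P a

end SchwarzianFlow

end

noncomputable section

namespace SchwarzianFlow

section

open Topology Filter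

/-! ### Coordinates -/

/-! Divide every characteristic by u_x, Q = u_x f, and put r = S^{-1/2}, J g = 2 S g' + S' g (`J2`).
Because S r² = 1, J r = 0 and Λ = (k2/2λ) r'''/u_x, choosing an antiderivative p of ΛQ amounts to
choosing a solution g of J g = -k2 f''', and then R[u]Q = u_x ((k1 + k2/2) f + g)
(`isPotential_iff`, `agrees_R`). Thus R[u] is a constant plus -k2 J⁻¹ D³, and its nonlocality is a
linear relation between f and g. The linearized operator of u_t = u_x b becomes f ↦ f_t + `ad b f`
(`linearized_mul`), so commutation with R[u] means that this map preserves the relation J g = f'''.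

The members are combinations of a basic hierarchy b_0 = r, J b_{n+1} = b_n'''. Its generating series
B satisfies J B = z B''', which has the first integral 2 S B² - z (2 B B'' - B'²) = 2. This
quadratic equation is solved algebraically, coefficient by coefficient. Hence no integration is
needed, and b_n is a function of S, ..., S_{2n}. The linearization of the equation at B is injective
on power series (`bil_lift_injective`), so an identity between variations of B may be checked after
applying it. Since S varies by f''' + J f under u_t = u_x f (`pr_sch`), such checks are short; they
show that the basic flows preserve J g = f''' (`J2_ad_dym`) and commute (`ad_dym_dym`). Moreover Q_j
/ u_x is λ (k1 + k2/2 - k2 T)^j b_0, where T shifts b_n to b_{n+1}.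

Integration constants are elements of the kernel of D_x, that is, functions of t and the sign of u_x
(`eq_of_D_eq_zero`). Jets of multiples of tan have constant Schwarzian and occur for all t and both
signs, so the zero normalization determines the antiderivative. A primitive in t corrects the
antiderivative when symmetries have to be mapped to symmetries (`exists_dt_primitive`). -/

/-- The space of coordinates `(x, t, u, ..., u_{nx})`. -/
abbrev Coord (n : ℕ) := ℝ × ℝ × (Fin (n + 1) → ℝ)

/-- Forget the coordinates of order above `n`. -/
def forget {m n : ℕ} (h : n ≤ m) : Coord m →L[ℝ] Coord n :=
  (ContinuousLinearMap.fst ℝ ℝ _).prod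
    (((ContinuousLinearMap.fst ℝ ℝ _).comp (ContinuousLinearMap.snd ℝ ℝ _)).prod
      (ContinuousLinearMap.pi fun i : Fin (n + 1) =>
        (ContinuousLinearMap.proj (R := ℝ) (φ := fun _ : Fin (m + 1) => ℝ)
          (Fin.castLE (by omega) i)).comp
          ((ContinuousLinearMap.snd ℝ ℝ _).comp (ContinuousLinearMap.snd ℝ ℝ _))))

@[simp] lemma forget_trunc {m n : ℕ} (h : n ≤ m) (a : Jet) : forget h (trunc m a) = trunc n a := rfl

/-- Clearing the denominator 2 u_x² turns S > 0 into one polynomial inequality, which by itself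
already excludes u_x = 0. -/
lemma mem_dom {a : Jet} : a ∈ dom ↔ 3 * a.u 2 ^ 2 < 2 * (a.u 1 * a.u 3) := by
  have key : ∀ h : a.u 1 ≠ 0, S a = (2 * (a.u 1 * a.u 3) - 3 * a.u 2 ^ 2) / (2 * a.u 1 ^ 2) := by
    intro h; unfold S; field_simp
  constructor
  · rintro ⟨h1, h2⟩
    rw [key h1] at h2
    have : 0 < 2 * a.u 1 ^ 2 := by positivity
    have := (div_pos_iff_of_pos_right this).1 h2
    linarith
  · intro h
    have h1 : a.u 1 ≠ 0 := by
      intro h0; rw [h0] at h; nlinarith [sq_nonneg (a.u 2)]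
    refine ⟨h1, ?_⟩
    rw [key h1]
    exact div_pos (by linarith) (by positivity)

/-- An arbitrary jet with given coordinates of order at most `n`. -/
def Jet.ofCoord {n : ℕ} (p : Coord n) : Jet where
  x := p.1
  t := p.2.1
  u k := if h : k < n + 1 then p.2.2 ⟨k, h⟩ else 0

@[simp] lemma trunc_ofCoord {n : ℕ} (p : Coord n) : trunc n (Jet.ofCoord p) = p := by
  refine Prod.ext rfl (Prod.ext rfl ?_)
  funext i
  simp only [trunc, Jet.ofCoord, dif_pos i.2]

lemma mem_dom_of_trunc_eq {n : ℕ} (hn : 3 ≤ n) {a b : Jet} (h : trunc n a = trunc n b)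
    (ha : a ∈ dom) : b ∈ dom := by
  have hu : ∀ k, k ≤ n → a.u k = b.u k := fun k hk =>
    congrFun (congrArg (fun p : Coord n => p.2.2) h) ⟨k, by omega⟩
  rw [mem_dom] at ha ⊢
  rwa [hu 1 (by omega), hu 2 (by omega), hu 3 (by omega)] at ha

lemma trunc_mem_image {n : ℕ} (hn : 3 ≤ n) {a : Jet} : trunc n a ∈ trunc n '' dom ↔ a ∈ dom :=
  ⟨fun ⟨_, hb, h⟩ => mem_dom_of_trunc_eq hn h hb, fun h => ⟨a, h, rfl⟩⟩

/-- From order 3 on the truncated coordinates decide membership in `dom`. This is why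
representatives are required to have n ≥ 3. -/
lemma isOpen_image {n : ℕ} (hn : 3 ≤ n) : IsOpen (trunc n '' dom) := by
  have : trunc n '' dom = {p : Coord n | 3 * p.2.2 ⟨2, by omega⟩ ^ 2 <
      2 * (p.2.2 ⟨1, by omega⟩ * p.2.2 ⟨3, by omega⟩)} := by
    ext p
    obtain ⟨a, rfl⟩ : ∃ a, trunc n a = p := ⟨_, trunc_ofCoord p⟩
    rw [trunc_mem_image hn, mem_dom]
    rfl
  rw [this]
  exact isOpen_lt (by fun_prop) (by fun_prop)

lemma forget_mapsTo {m n : ℕ} (h : n ≤ m) :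
    Set.MapsTo (forget h) (trunc m '' dom) (trunc n '' dom) := by
  rintro _ ⟨a, ha, rfl⟩
  exact ⟨a, ha, rfl⟩

/-! ### Representatives of differential functions -/

/-- On `dom`, `F` is given by the smooth function `f` of the coordinates of order at most `n`. -/
structure IsRep (n : ℕ) (f : Coord n → ℝ) (F : Jet → ℝ) : Prop where
  le : 3 ≤ n
  smooth : ContDiffOn ℝ ∞ f (trunc n '' dom)
  eq : ∀ a ∈ dom, F a = f (trunc n a)

lemma HasOrderLE.exists_isRep {n : ℕ} {F : Jet → ℝ} (h : HasOrderLE n F) {m : ℕ} (hm : 3 ≤ m)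
    (hnm : n ≤ m) : ∃ f, IsRep m f F := by
  obtain ⟨f, hf, he⟩ := h
  exact ⟨f ∘ forget hnm, hm, hf.comp (forget hnm).contDiff.contDiffOn (forget_mapsTo hnm),
    fun a ha => he a ha⟩

lemma IsRep.hasOrderLE {n : ℕ} {f : Coord n → ℝ} {F : Jet → ℝ} (h : IsRep n f F) :
    HasOrderLE n F := ⟨f, h.smooth, h.eq⟩

lemma IsRep.differentiableAt {n : ℕ} {f : Coord n → ℝ} {F : Jet → ℝ} (h : IsRep n f F) {a : Jet}
    (ha : a ∈ dom) : DifferentiableAt ℝ f (trunc n a) :=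
  (h.smooth.contDiffAt ((isOpen_image h.le).mem_nhds ⟨a, ha, rfl⟩)).differentiableAt (by simp)

lemma IsRep.hasDerivAt {n : ℕ} {f : Coord n → ℝ} {F : Jet → ℝ} (h : IsRep n f F) {γ : ℝ → Jet}
    {y : ℝ} {w : Coord n} (hγ : HasDerivAt (fun z => trunc n (γ z)) w y) (hy : γ y ∈ dom) :
    HasDerivAt (fun z => F (γ z)) (fderiv ℝ f (trunc n (γ y)) w) y := by
  have h1 : HasDerivAt (fun z => f (trunc n (γ z))) (fderiv ℝ f (trunc n (γ y)) w) y :=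
    (h.differentiableAt hy).hasFDerivAt.comp_hasDerivAt y hγ
  refine h1.congr_of_eventuallyEq ?_
  filter_upwards [hγ.continuousAt.preimage_mem_nhds
    ((isOpen_image h.le).mem_nhds ⟨γ y, hy, rfl⟩)] with z hz
  exact h.eq _ ((trunc_mem_image h.le).1 hz)

/-- The derivative of `F` in the direction with components `v`. -/
def along (v : Jet) (F : Jet → ℝ) (a : Jet) : ℝ :=
  v.x * partialX F a + v.t * partialT F a + ∑ᶠ k, v.u k * partialU k F a

lemma IsRep.partialX {n : ℕ} {f : Coord n → ℝ} {F : Jet → ℝ} (h : IsRep n f F) {a : Jet}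
    (ha : a ∈ dom) : partialX F a = fderiv ℝ f (trunc n a) (1, 0, 0) := by
  have : HasDerivAt (fun y => trunc n { a with x := y }) ((1, 0, 0) : Coord n) a.x :=
    (hasDerivAt_id a.x).prodMk (hasDerivAt_const a.x (trunc n a).2)
  exact (h.hasDerivAt this ha).deriv

lemma IsRep.partialT {n : ℕ} {f : Coord n → ℝ} {F : Jet → ℝ} (h : IsRep n f F) {a : Jet}
    (ha : a ∈ dom) : partialT F a = fderiv ℝ f (trunc n a) (0, 1, 0) := by
  have : HasDerivAt (fun y => trunc n { a with t := y }) ((0, 1, 0) : Coord n) a.t :=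
    (hasDerivAt_const _ _).prodMk ((hasDerivAt_id a.t).prodMk
      (hasDerivAt_const a.t (trunc n a).2.2))
  exact (h.hasDerivAt this ha).deriv

lemma IsRep.partialU {n : ℕ} {f : Coord n → ℝ} {F : Jet → ℝ} (h : IsRep n f F) {a : Jet}
    (ha : a ∈ dom) (k : ℕ) :
    partialU k F a = fderiv ℝ f (trunc n a) (0, 0, fun i => if (i : ℕ) = k then 1 else 0) := by
  have : HasDerivAt (fun y => trunc n { a with u := Function.update a.u k y })
      ((0, 0, fun i => if (i : ℕ) = k then 1 else 0) : Coord n) (a.u k) := by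
    refine (hasDerivAt_const _ _).prodMk ((hasDerivAt_const _ _).prodMk (hasDerivAt_pi.2 ?_))
    intro i
    by_cases hi : (i : ℕ) = k
    · simpa [hi] using hasDerivAt_id' (a.u k)
    · simpa [hi] using hasDerivAt_const (a.u k) (a.u i)
  have h2 := h.hasDerivAt this (by simpa using ha)
  simpa [SchwarzianFlow.partialU] using h2.deriv

/-- `Dx`, `frechet` and the partial derivatives are all instances of `along`. Coordinates of order
above n contribute nothing, so the formal sum is the Fréchet derivative of a representative. -/
lemma IsRep.along {n : ℕ} {f : Coord n → ℝ} {F : Jet → ℝ} (h : IsRep n f F) {a : Jet}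
    (ha : a ∈ dom) (v : Jet) : along v F a = fderiv ℝ f (trunc n a) (trunc n v) := by
  have hs : ∑ᶠ k, v.u k * SchwarzianFlow.partialU k F a =
      ∑ k ∈ Finset.range (n + 1), v.u k * SchwarzianFlow.partialU k F a := by
    refine finsum_eq_sum_of_support_subset _ ?_
    intro k hk
    simp only [Finset.coe_range, Set.mem_Iio]
    by_contra hlt
    apply hk
    have : (fun i : Fin (n + 1) => if (i : ℕ) = k then (1 : ℝ) else 0) = 0 := by
      funext i
      have := i.2
      simp only [Pi.zero_apply, ite_eq_right_iff]
      omega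
    show v.u k * SchwarzianFlow.partialU k F a = 0
    rw [h.partialU ha, this]
    have h0 : ((0, 0, 0) : Coord n) = 0 := rfl
    rw [h0, map_zero, mul_zero]
  have hv : trunc n v = v.x • ((1, 0, 0) : Coord n) + v.t • ((0, 1, 0) : Coord n) +
      ∑ k ∈ Finset.range (n + 1),
        v.u k • ((0, 0, fun i => if (i : ℕ) = k then 1 else 0) : Coord n) := by
    refine Prod.ext ?_ (Prod.ext ?_ ?_)
    · simp [trunc, Prod.fst_sum]
    · simp [trunc, Prod.fst_sum, Prod.snd_sum]
    · funext i
      simp [trunc, Prod.snd_sum, Finset.sum_apply, Nat.lt_succ_iff.1 i.2]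
  rw [hv, map_add, map_add, map_smul, map_smul, map_sum]
  simp only [map_smul, smul_eq_mul, ← h.partialX ha, ← h.partialT ha, ← h.partialU ha]
  rw [SchwarzianFlow.along, hs]

lemma along_congr {F G : Jet → ℝ} (hG : IsDiffFun G) (h : ∀ a ∈ dom, F a = G a) {a : Jet}
    (ha : a ∈ dom) (v : Jet) : along v F a = along v G a := by
  obtain ⟨n, hn⟩ := hG
  obtain ⟨f, hf⟩ := hn.exists_isRep (le_max_right n 3) (le_max_left n 3)
  have hf' : IsRep _ f F := ⟨hf.le, hf.smooth, fun b hb => (h b hb).trans (hf.eq b hb)⟩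
  rw [hf.along ha, hf'.along ha]

lemma Dx_eq_along (F : Jet → ℝ) (a : Jet) : Dx F a = along ⟨1, 0, fun k => a.u (k + 1)⟩ F a := by
  simp [Dx, along]

lemma frechet_eq_along (F V : Jet → ℝ) (a : Jet) :
    frechet F V a = along ⟨0, 0, fun k => Dx^[k] V a⟩ F a := by
  simp [frechet, along, mul_comm]

lemma partialT_eq_along (F : Jet → ℝ) (a : Jet) : partialT F a = along ⟨0, 1, 0⟩ F a := by
  simp [along]

lemma partialU_eq_along (k : ℕ) (F : Jet → ℝ) (a : Jet) :
    partialU k F a = along ⟨0, 0, Pi.single k 1⟩ F a := by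
  have : ∀ l, (Pi.single k 1 : ℕ → ℝ) l * partialU l F a = if l = k then partialU k F a else 0 := by
    intro l
    by_cases h : l = k
    · subst h; simp
    · simp [h]
  have h0 := finsum_eq_single (fun l => if l = k then partialU k F a else 0) k
    fun l hl => if_neg hl
  simp [along, this, h0]

/-! ### The algebra of differential functions -/

open Classical in
/-- Extension by zero of a function on `dom`. -/
def ext (F : dom → ℝ) (a : Jet) : ℝ := if h : a ∈ dom then F ⟨a, h⟩ else 0

lemma ext_apply (F : dom → ℝ) {a : Jet} (ha : a ∈ dom) : ext F a = F ⟨a, ha⟩ := by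
  simp [ext, ha]

lemma exists_common_rep {ι : Type*} [Finite ι] {F : ι → Jet → ℝ} (h : ∀ i, IsDiffFun (F i))
    (n : ℕ) : ∃ N, n ≤ N ∧ ∃ f : ι → Coord N → ℝ, ∀ i, IsRep N (f i) (F i) := by
  choose m hm using h
  obtain ⟨M, hM⟩ := (Set.finite_range m).bddAbove
  have hM' : ∀ i, m i ≤ M := fun i => hM ⟨i, rfl⟩
  have : ∀ i, ∃ f, IsRep (max (max M n) 3) f (F i) := fun i =>
    (hm i).exists_isRep (le_max_right _ _) (by have := hM' i; omega)
  choose f hf using this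
  exact ⟨_, by omega, f, hf⟩

lemma isDiffFun_comp {ι : Type*} [Fintype ι] {F : ι → Jet → ℝ} (h : ∀ i, IsDiffFun (F i))
    {Ψ : (ι → ℝ) → ℝ} {O : Set (ι → ℝ)} (hΨ : ContDiffOn ℝ ∞ Ψ O)
    (hO : ∀ a ∈ dom, (fun i => F i a) ∈ O) : IsDiffFun fun a => Ψ fun i => F i a := by
  obtain ⟨N, -, f, hf⟩ := exists_common_rep h 0
  refine ⟨N, fun p => Ψ fun i => f i p, ?_, ?_⟩
  · refine hΨ.comp (contDiffOn_pi.2 fun i => (hf i).smooth) ?_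
    rintro _ ⟨a, ha, rfl⟩
    have : (fun i => f i (trunc N a)) = fun i => F i a := funext fun i => ((hf i).eq a ha).symm
    show (fun i => f i (trunc N a)) ∈ O
    rw [this]
    exact hO a ha
  · intro a ha
    show Ψ _ = Ψ _
    congr 1
    exact funext fun i => (hf i).eq a ha

lemma isDiffFun_of_contDiff {n : ℕ} {f : Coord n → ℝ} (hf : ContDiff ℝ ∞ f) :
    IsDiffFun fun a => f (trunc n a) := ⟨n, f, hf.contDiffOn, fun _ _ => rfl⟩

lemma IsDiffFun.congr {F G : Jet → ℝ} (hF : IsDiffFun F) (h : ∀ a ∈ dom, G a = F a) :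
    IsDiffFun G := by
  obtain ⟨n, f, hf, he⟩ := hF
  exact ⟨n, f, hf, fun a ha => (h a ha).trans (he a ha)⟩

lemma IsDiffFun.comp₂ {F G : Jet → ℝ} (hF : IsDiffFun F) (hG : IsDiffFun G) {Ψ : (Fin 2 → ℝ) → ℝ}
    (hΨ : ContDiff ℝ ∞ Ψ) : IsDiffFun fun a => Ψ ![F a, G a] := by
  refine (isDiffFun_comp (ι := Fin 2) (F := ![F, G]) ?_ hΨ.contDiffOn
    fun a _ => Set.mem_univ _).congr ?_
  · intro i; fin_cases i <;> assumption
  · intro a _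
    congr 1
    funext i; fin_cases i <;> rfl

/-- The algebra of differential functions, as functions on `dom`. -/
def DiffFun : Subalgebra ℝ (dom → ℝ) where
  carrier := {F | IsDiffFun (ext F)}
  mul_mem' {F G} hF hG := (hF.comp₂ hG (Ψ := fun w => w 0 * w 1) (by fun_prop)).congr
    fun a ha => by simp [ext_apply _ ha]
  add_mem' {F G} hF hG := (hF.comp₂ hG (Ψ := fun w => w 0 + w 1) (by fun_prop)).congr
    fun a ha => by simp [ext_apply _ ha]
  algebraMap_mem' r := (isDiffFun_of_contDiff (n := 0) (f := fun _ => r) contDiff_const).congr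
    fun a ha => by simp [ext_apply _ ha]

/-- The function `F` agrees on `dom` with the element `α` of the algebra `DiffFun`. -/
def Agrees (F : Jet → ℝ) (α : DiffFun) : Prop := ∀ a (ha : a ∈ dom), F a = α.1 ⟨a, ha⟩

lemma agrees_ext (α : DiffFun) : Agrees (ext α.1) α := fun _ ha => ext_apply _ ha

lemma Agrees.isDiffFun {F : Jet → ℝ} {α : DiffFun} (h : Agrees F α) : IsDiffFun F :=
  α.2.congr fun a ha => (h a ha).trans (agrees_ext α a ha).symm

lemma IsDiffFun.exists_agrees {F : Jet → ℝ} (h : IsDiffFun F) : ∃ α, Agrees F α :=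
  ⟨⟨fun a => F a, h.congr fun a ha => by rw [ext_apply _ ha]⟩, fun _ _ => rfl⟩

lemma Agrees.unique {F : Jet → ℝ} {α β : DiffFun} (h : Agrees F α) (h' : Agrees F β) : α = β :=
  Subtype.ext (funext fun a => (h a a.2).symm.trans (h' a a.2))

lemma Agrees.congr_iff {F G : Jet → ℝ} {α β : DiffFun} (h : Agrees F α) (h' : Agrees G β) :
    (∀ a ∈ dom, F a = G a) ↔ α = β := by
  constructor
  · intro hFG
    exact h.unique fun a ha => (hFG a ha).trans (h' a ha)
  · rintro rfl a ha
    rw [h a ha, h' a ha]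

/-! ### Vector fields as derivations, and their commutators -/

/-- A vector field on the jet space with differential functions as components. -/
structure VF where
  x : DiffFun
  t : DiffFun
  u : ℕ → DiffFun

/-- The components of a vector field at a point. -/
def VF.at (V : VF) (a : dom) : Jet := ⟨V.x.1 a, V.t.1 a, fun k => (V.u k).1 a⟩

/-- A representative of the components of order at most `n` of a vector field. -/
lemma VF.exists_rep (V : VF) (n : ℕ) : ∃ N, n ≤ N ∧ 3 ≤ N ∧ ∃ v : Coord N → Coord n,
    ContDiffOn ℝ ∞ v (trunc N '' dom) ∧ (∀ a : dom, trunc n (V.at a) = v (trunc N a)) ∧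
    IsRep N (fun p => (v p).1) (ext V.x.1) ∧ IsRep N (fun p => (v p).2.1) (ext V.t.1) ∧
    ∀ i, IsRep N (fun p => (v p).2.2 i) (ext (V.u i).1) := by
  let F : Option (Option (Fin (n + 1))) → Jet → ℝ := fun i => match i with
    | none => ext V.x.1
    | some none => ext V.t.1
    | some (some i) => ext (V.u i).1
  have hF : ∀ i, IsDiffFun (F i) := by
    rintro (_ | _ | i)
    exacts [V.x.2, V.t.2, (V.u i).2]
  obtain ⟨N, hN, f, hf⟩ := exists_common_rep hF n
  refine ⟨N, hN, (hf none).le, fun p => (f none p, f (some none) p, fun i => f (some (some i)) p),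
    ?_, ?_, hf none, hf (some none), fun i => hf (some (some i))⟩
  · exact (hf none).smooth.prodMk ((hf (some none)).smooth.prodMk
      (contDiffOn_pi.2 fun i => (hf (some (some i))).smooth))
  · intro a
    refine Prod.ext ?_ (Prod.ext ?_ (funext fun i => ?_))
    · exact (agrees_ext V.x a a.2).symm.trans ((hf none).eq a a.2)
    · exact (agrees_ext V.t a a.2).symm.trans ((hf (some none)).eq a a.2)
    · exact (agrees_ext (V.u i) a a.2).symm.trans ((hf (some (some i))).eq a a.2)

/-- The order may grow from n to N because the components of V may involve higher derivatives than F
does. -/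
lemma isRep_der {n N : ℕ} (hN : n ≤ N) {f : Coord n → ℝ} {F : Jet → ℝ} (hf : IsRep n f F)
    {v : Coord N → Coord n} (hv : ContDiffOn ℝ ∞ v (trunc N '' dom)) {V : VF}
    (hV : ∀ a : dom, trunc n (V.at a) = v (trunc N a)) {G : Jet → ℝ}
    (hG : ∀ a : dom, G a = along (V.at a) F a) :
    IsRep N (fun p => fderiv ℝ f (forget hN p) (v p)) G := by
  refine ⟨hf.le.trans hN, ?_, ?_⟩
  · exact ((hf.smooth.fderiv_of_isOpen (isOpen_image hf.le) (by simp)).comp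
      (forget hN).contDiff.contDiffOn (forget_mapsTo hN)).clm_apply hv
  · intro a ha
    rw [hG ⟨a, ha⟩, hf.along ha, hV ⟨a, ha⟩, forget_trunc]

lemma exists_rep_of (α : DiffFun) (m : ℕ) : ∃ n, m ≤ n ∧ ∃ f, IsRep n f (ext α.1) := by
  obtain ⟨N, hN, f, hf⟩ := exists_common_rep (ι := Unit) (fun _ => α.2) m
  exact ⟨N, hN, f (), hf ()⟩

lemma exists_rep₂ (α β : DiffFun) : ∃ n f g, IsRep n f (ext α.1) ∧ IsRep n g (ext β.1) := by
  obtain ⟨n, -, f, hf⟩ := exists_common_rep (ι := Bool) (F := fun i => ext (cond i α β).1)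
    (fun i => (cond i α β).2) 0
  exact ⟨n, f true, f false, hf true, hf false⟩

lemma along_isDiffFun (V : VF) (α : DiffFun) :
    IsDiffFun (ext fun a : dom => along (V.at a) (ext α.1) a) := by
  obtain ⟨n, -, f, hf⟩ := exists_rep_of α 0
  obtain ⟨N, hN, -, v, hv, hV, -⟩ := V.exists_rep n
  exact ⟨N, (isRep_der hN hf hv hV fun a => ext_apply _ a.2).hasOrderLE⟩

lemma along_ext_add (v : Jet) (α β : DiffFun) {a : Jet} (ha : a ∈ dom) :
    along v (ext (α + β).1) a = along v (ext α.1) a + along v (ext β.1) a := by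
  obtain ⟨n, f, g, hf, hg⟩ := exists_rep₂ α β
  have hadd : IsRep n (f + g) (ext (α + β).1) :=
    ⟨hf.le, hf.smooth.add hg.smooth, fun b hb => by
      have h1 := hf.eq b hb
      have h2 := hg.eq b hb
      rw [ext_apply _ hb] at h1 h2 ⊢
      exact congrArg₂ (· + ·) h1 h2⟩
  rw [hadd.along ha, hf.along ha, hg.along ha,
    fderiv_add (hf.differentiableAt ha) (hg.differentiableAt ha)]
  rfl

lemma along_ext_smul (v : Jet) (r : ℝ) (α : DiffFun) {a : Jet} (ha : a ∈ dom) :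
    along v (ext (r • α).1) a = r * along v (ext α.1) a := by
  obtain ⟨n, -, f, hf⟩ := exists_rep_of α 0
  have hsmul : IsRep n (r • f) (ext (r • α).1) :=
    ⟨hf.le, hf.smooth.const_smul r, fun b hb => by
      have h1 := hf.eq b hb
      rw [ext_apply _ hb] at h1 ⊢
      exact congrArg (r * ·) h1⟩
  rw [hsmul.along ha, hf.along ha, fderiv_const_smul (hf.differentiableAt ha)]
  rfl

lemma along_ext_mul (v : Jet) (α β : DiffFun) {a : Jet} (ha : a ∈ dom) :
    along v (ext (α * β).1) a =
      ext α.1 a * along v (ext β.1) a + ext β.1 a * along v (ext α.1) a := by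
  obtain ⟨n, f, g, hf, hg⟩ := exists_rep₂ α β
  have hmul : IsRep n (f * g) (ext (α * β).1) :=
    ⟨hf.le, hf.smooth.mul hg.smooth, fun b hb => by
      have h1 := hf.eq b hb
      have h2 := hg.eq b hb
      rw [ext_apply _ hb] at h1 h2 ⊢
      exact congrArg₂ (· * ·) h1 h2⟩
  rw [hmul.along ha, hf.along ha, hg.along ha, hf.eq a ha, hg.eq a ha,
    fderiv_mul (hf.differentiableAt ha) (hg.differentiableAt ha)]
  rfl

/-- The derivation of the algebra of differential functions defined by a vector field, as a
linear map. -/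
def VF.lin (V : VF) : DiffFun →ₗ[ℝ] DiffFun where
  toFun α := ⟨fun a => along (V.at a) (ext α.1) a, along_isDiffFun V α⟩
  map_add' α β := Subtype.ext (funext fun a => along_ext_add _ α β a.2)
  map_smul' r α := Subtype.ext (funext fun a => along_ext_smul _ r α a.2)

/-- The derivation of the algebra of differential functions defined by a vector field. -/
def VF.der (V : VF) : Derivation ℝ DiffFun DiffFun :=
  Derivation.mk' V.lin fun α β => Subtype.ext (funext fun a => by
    have := along_ext_mul (V.at a) α β a.2
    rw [ext_apply _ a.2, ext_apply _ a.2] at this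
    exact this)

lemma VF.der_apply (V : VF) (α : DiffFun) (a : dom) :
    (V.der α).1 a = along (V.at a) (ext α.1) a := rfl

lemma Agrees.along {F : Jet → ℝ} {α : DiffFun} (h : Agrees F α) (V : VF) (a : dom) :
    along (V.at a) F a = (V.der α).1 a :=
  along_congr α.2 (fun b hb => (h b hb).trans (agrees_ext α b hb).symm) a.2 _

/-- Componentwise derivative of a vector field. -/
def VF.act (V W : VF) : VF := ⟨V.der W.x, V.der W.t, fun k => V.der (W.u k)⟩

/-- The commutator of two vector fields. -/
theorem VF.der_der (V W : VF) (α : DiffFun) :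
    V.der (W.der α) - (V.act W).der α = W.der (V.der α) - (W.act V).der α := by
  refine Subtype.ext (funext fun a => ?_)
  obtain ⟨n, -, f, hf⟩ := exists_rep_of α 0
  have hsymm : IsSymmSndFDerivAt ℝ f (trunc n a) :=
    (hf.smooth.contDiffAt ((isOpen_image hf.le).mem_nhds ⟨a, a.2, rfl⟩)).isSymmSndFDerivAt
      (by rw [minSmoothness_of_isRCLikeNormedField]; exact ENat.LEInfty.out)
  -- Once the term in which V differentiates the components of W is removed, only the second
  -- derivative of a representative on the pair (V, W) remains, and that is symmetric.
  have key : ∀ V W : VF, (V.der (W.der α)).1 a - ((V.act W).der α).1 a =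
      fderiv ℝ (fderiv ℝ f) (trunc n a) (trunc n (V.at a)) (trunc n (W.at a)) := by
    intro V W
    obtain ⟨N, hN, hN3, w, hw, hW, hx, ht, hu⟩ := W.exists_rep n
    have hrep : IsRep N _ (ext (W.der α).1) := isRep_der hN hf hw hW fun b => by
      rw [ext_apply _ b.2]; rfl
    have hO := (isOpen_image hN3).mem_nhds ⟨a.1, a.2, rfl⟩
    have hdw : DifferentiableAt ℝ w (trunc N a) := (hw.contDiffAt hO).differentiableAt (by simp)
    have hdf : DifferentiableAt ℝ (fderiv ℝ f) (trunc n a) :=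
      ((hf.smooth.fderiv_of_isOpen (m := ∞) (isOpen_image hf.le) (by simp)).contDiffAt
        ((isOpen_image hf.le).mem_nhds ⟨a, a.2, rfl⟩)).differentiableAt (by simp)
    have hdf' : HasFDerivAt (fun p => fderiv ℝ f (forget hN p))
        ((fderiv ℝ (fderiv ℝ f) (trunc n a)).comp (forget hN)) (trunc N a) :=
      HasFDerivAt.comp (trunc N a.1) (by simpa using hdf.hasFDerivAt)
        (forget hN).hasFDerivAt
    have hwV : fderiv ℝ w (trunc N a) (trunc N (V.at a)) = trunc n ((V.act W).at a) := by
      have h1 := hdw.hasFDerivAt.fst.fderiv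
      have h2 := hdw.hasFDerivAt.snd.fst.fderiv
      have h3 := fun i => ((hasFDerivAt_pi'.1 hdw.hasFDerivAt.snd.snd) i).fderiv
      refine Prod.ext ?_ (Prod.ext ?_ (funext fun i => ?_))
      · have : along (V.at a) (ext W.x.1) a = _ := hx.along a.2 (V.at a)
        rw [h1] at this
        exact this.symm
      · have : along (V.at a) (ext W.t.1) a = _ := ht.along a.2 (V.at a)
        rw [h2] at this
        exact this.symm
      · have : along (V.at a) (ext (W.u i).1) a = _ := (hu i).along a.2 (V.at a)
        rw [h3 i] at this
        exact this.symm
    rw [V.der_apply, hrep.along a.2, (hdf'.clm_apply hdw.hasFDerivAt).fderiv, VF.der_apply,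
      hf.along a.2, hW a, ← hwV]
    simp
  show (V.der (W.der α)).1 a - ((V.act W).der α).1 a = (W.der (V.der α)).1 a - ((W.act V).der α).1 a
  rw [key, key, hsymm]

end

section

open Topology Filter

/-! ### Chain rule and coordinates -/

lemma VF.der_eq_fderiv (α : DiffFun) : ∃ (n : ℕ) (f : Coord n → ℝ), ∀ (V : VF) (a : dom),
    (V.der α).1 a = fderiv ℝ f (trunc n a) (trunc n (V.at a)) := by
  obtain ⟨n, -, f, hf⟩ := exists_rep_of α 0
  exact ⟨n, f, fun V a => hf.along a.2 _⟩

/-- Smooth functions of differential functions are differential functions. -/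
theorem exists_smooth_comp {ι : Type*} [Fintype ι] (F : ι → DiffFun) {Ψ : (ι → ℝ) → ℝ}
    {O : Set (ι → ℝ)} (hO : IsOpen O) (hΨ : ContDiffOn ℝ ∞ Ψ O)
    (hF : ∀ a, (fun i => (F i).1 a) ∈ O) :
    ∃ α : DiffFun, (∀ a, α.1 a = Ψ fun i => (F i).1 a) ∧
      ∀ (V : VF) (a : dom), (V.der α).1 a =
        fderiv ℝ Ψ (fun i => (F i).1 a) fun i => (V.der (F i)).1 a := by
  have hd : IsDiffFun fun a => Ψ fun i => ext (F i).1 a :=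
    isDiffFun_comp (fun i => (F i).2) hΨ fun a ha => by simpa only [ext_apply _ ha] using hF ⟨a, ha⟩
  obtain ⟨α, hag⟩ := hd.exists_agrees
  refine ⟨α, fun a => ?_, fun V a => ?_⟩
  · rw [← hag a a.2]
    simp only [ext_apply _ a.2]
  rw [← hag.along V a]
  obtain ⟨N, -, f, hf⟩ := exists_common_rep (fun i => (F i).2) 0
  -- The bound 3 ≤ N is read off from one of the representatives, so an empty family needs its own
  -- argument; there the function is constant.
  rcases isEmpty_or_nonempty ι with hι | ⟨⟨i₀⟩⟩
  · have h1 : IsRep 3 (fun _ => Ψ fun i => 0) (fun a => Ψ fun i => ext (F i).1 a) :=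
      ⟨le_rfl, contDiffOn_const, fun b _ => congrArg Ψ (funext fun i => hι.elim i)⟩
    rw [h1.along a.2]
    have h2 : (fun i => (V.der (F i)).1 a) = 0 := funext fun i => hι.elim i
    rw [h2]
    simp
  have hval : ∀ b ∈ dom, (fun i => f i (trunc N b)) = fun i => ext (F i).1 b := fun b hb =>
    funext fun i => ((hf i).eq b hb).symm
  have hrep : IsRep N (fun p => Ψ fun i => f i p) (fun a => Ψ fun i => ext (F i).1 a) := by
    refine ⟨(hf i₀).le, ?_, ?_⟩
    · refine hΨ.comp (contDiffOn_pi.2 fun i => (hf i).smooth) ?_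
      rintro _ ⟨b, hb, rfl⟩
      show (fun i => f i (trunc N b)) ∈ O
      rw [hval b hb]
      simpa only [ext_apply _ hb] using hF ⟨b, hb⟩
    · intro b hb
      show Ψ _ = Ψ _
      rw [hval b hb]
  have hva : (fun i => f i (trunc N a.1)) = fun i => (F i).1 a := by
    rw [hval a.1 a.2]
    exact funext fun i => ext_apply _ a.2
  have hΨd : DifferentiableAt ℝ Ψ (fun i => f i (trunc N a.1)) := by
    rw [hva]
    exact (hΨ.contDiffAt (hO.mem_nhds (hF a))).differentiableAt (by simp)
  have hfd : HasFDerivAt (fun p i => f i p)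
      (ContinuousLinearMap.pi fun i => fderiv ℝ (f i) (trunc N a.1)) (trunc N a.1) :=
    hasFDerivAt_pi.2 fun i => ((hf i).differentiableAt a.2).hasFDerivAt
  have hc := (hΨd.hasFDerivAt.comp (trunc N a.1) hfd).fderiv
  rw [hrep.along a.2]
  change fderiv ℝ (Ψ ∘ fun p i => f i p) (trunc N a.1) _ = _
  rw [hc, hva]
  show fderiv ℝ Ψ _ _ = _
  congr 1
  exact funext fun i => ((hf i).along a.2 _).symm

lemma VF.der_of_linear {n : ℕ} (hn : 3 ≤ n) (l : Coord n →L[ℝ] ℝ) {α : DiffFun}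
    (hα : ∀ a : dom, α.1 a = l (trunc n a)) (V : VF) (a : dom) :
    (V.der α).1 a = l (trunc n (V.at a)) := by
  have h : IsRep n l (ext α.1) :=
    ⟨hn, l.contDiff.contDiffOn, fun b hb => by rw [ext_apply _ hb, hα]⟩
  rw [V.der_apply, h.along a.2, l.fderiv]

/-- The coordinate `u_{kx}`. -/
def coordU (k : ℕ) : DiffFun := ⟨fun a => a.1.u k, by
  refine (isDiffFun_of_contDiff (n := k) (f := fun p => p.2.2 ⟨k, by omega⟩) ?_).congr ?_
  · fun_prop
  · exact fun a ha => ext_apply _ ha⟩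

@[simp] lemma VF.der_coordU (V : VF) (k : ℕ) : V.der (coordU k) = V.u k :=
  Subtype.ext (funext fun a => VF.der_of_linear (n := k + 3) (by omega)
    ((ContinuousLinearMap.proj (R := ℝ) (φ := fun _ : Fin (k + 3 + 1) => ℝ)
      ⟨k, by omega⟩).comp ((ContinuousLinearMap.snd ℝ ℝ _).comp (ContinuousLinearMap.snd ℝ ℝ _)))
    (fun _ => rfl) V a)

lemma exists_smooth_comp_one (α : DiffFun) {ψ : ℝ → ℝ} {O : Set ℝ} (hO : IsOpen O)
    (hψ : ContDiffOn ℝ ∞ ψ O) (hα : ∀ a, α.1 a ∈ O) :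
    ∃ β : DiffFun, ∀ a, β.1 a = ψ (α.1 a) := by
  obtain ⟨β, hβ, -⟩ := exists_smooth_comp (fun _ : Unit => α) (Ψ := fun w => ψ (w ()))
    (O := (fun w : Unit → ℝ => w ()) ⁻¹' O) (hO.preimage (by fun_prop))
    (hψ.comp (by fun_prop) fun _ h => h) hα
  exact ⟨β, hβ⟩

/-! ### The basic vector fields -/

/-- The vector field of the total derivative `D_x`. -/
def vfD : VF := ⟨1, 0, fun k => coordU (k + 1)⟩

/-- The total derivative `D_x`. -/
def D : Derivation ℝ DiffFun DiffFun := vfD.der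

/-- The prolongation of the evolutionary vector field `Q ∂/∂u`. -/
def vfPr (Q : DiffFun) : VF := ⟨0, 0, fun k => D^[k] Q⟩

/-- The derivation defined by the prolongation of `Q ∂/∂u`. -/
def pr (Q : DiffFun) : Derivation ℝ DiffFun DiffFun := (vfPr Q).der

/-- The vector field `∂/∂t`. -/
def vfT : VF := ⟨0, 1, 0⟩

/-- The derivation `∂/∂t`. -/
def dt : Derivation ℝ DiffFun DiffFun := vfT.der

/-- The vector field `∂/∂u_{kx}`. -/
def vfU (k : ℕ) : VF := ⟨0, 0, Pi.single k 1⟩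

/-- The derivation `∂/∂u_{kx}`. -/
def du (k : ℕ) : Derivation ℝ DiffFun DiffFun := (vfU k).der

@[simp] lemma D_coordU (k : ℕ) : D (coordU k) = coordU (k + 1) := VF.der_coordU _ _
@[simp] lemma pr_coordU (Q : DiffFun) (k : ℕ) : pr Q (coordU k) = D^[k] Q := VF.der_coordU _ _
@[simp] lemma dt_coordU (k : ℕ) : dt (coordU k) = 0 := VF.der_coordU _ _
lemma du_coordU (k l : ℕ) : du k (coordU l) = (Pi.single k 1 : ℕ → DiffFun) l := VF.der_coordU _ _

lemma VF.der_zero (α : DiffFun) : (⟨0, 0, 0⟩ : VF).der α = 0 := by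
  obtain ⟨n, f, h⟩ := VF.der_eq_fderiv α
  refine Subtype.ext (funext fun a => ?_)
  rw [h]
  exact map_zero _

/-- Differentiating the components of either field along the other gives D^{k+1} Q in place k, so
the commutator vanishes. -/
lemma pr_D (Q α : DiffFun) : pr Q (D α) = D (pr Q α) := by
  have h := VF.der_der (vfPr Q) vfD α
  have h1 : (vfPr Q).act vfD = vfD.act (vfPr Q) := by
    simp only [VF.act, vfD, vfPr, map_zero, Derivation.map_one_eq_zero, VF.der_coordU]
    congr 1
    exact funext fun k => Function.iterate_succ_apply' _ _ _
  rw [h1, sub_left_inj] at h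
  exact h

lemma dt_D (α : DiffFun) : dt (D α) = D (dt α) := by
  have h := VF.der_der vfT vfD α
  have h1 : vfT.act vfD = vfD.act vfT := by
    simp only [VF.act, vfD, vfT, map_zero, Derivation.map_one_eq_zero, VF.der_coordU]
    congr 1
    exact funext fun k => by simp
  rw [h1, sub_left_inj] at h
  exact h

/-- The coordinate u_{(k+1)x} occurs in D_x only as the coefficient of ∂/∂u_{kx}. -/
lemma du_succ_D (k : ℕ) (α : DiffFun) : du (k + 1) (D α) = D (du (k + 1) α) + du k α := by
  have h := VF.der_der (vfU (k + 1)) vfD α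
  have h1 : (vfU (k + 1)).act vfD = vfU k := by
    simp only [VF.act, vfD, vfU, map_zero, Derivation.map_one_eq_zero, VF.der_coordU]
    congr 1
    funext l
    rw [Pi.single_apply, Pi.single_apply]
    simp
  have h2 : vfD.act (vfU (k + 1)) = ⟨0, 0, 0⟩ := by
    simp only [VF.act, vfU, map_zero]
    congr 1
    funext l
    rw [Pi.single_apply]
    split_ifs <;> simp
  rw [h1, h2, VF.der_zero, sub_zero, sub_eq_iff_eq_add] at h
  exact h

lemma iterate_D_mul_of_const {γ : DiffFun} (hγ : D γ = 0) (k : ℕ) (α : DiffFun) :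
    D^[k] (γ * α) = γ * D^[k] α := by
  induction k with
  | zero => rfl
  | succ k ih =>
    rw [Function.iterate_succ_apply', ih, Function.iterate_succ_apply', Derivation.leibniz, hγ]
    simp

lemma pr_add (P Q α : DiffFun) : pr (P + Q) α = pr P α + pr Q α := by
  obtain ⟨n, f, h⟩ := VF.der_eq_fderiv α
  refine Subtype.ext (funext fun a => ?_)
  show ((vfPr (P + Q)).der α).1 a = ((vfPr P).der α).1 a + ((vfPr Q).der α).1 a
  rw [h, h, h, ← map_add]
  congr 1
  refine Prod.ext (by simp [trunc, VF.at, vfPr]) (Prod.ext (by simp [trunc, VF.at, vfPr])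
    (funext fun i => ?_))
  simp [trunc, VF.at, vfPr]

/-- Prolongation is linear over the kernel of D, which is what allows integration constants
depending on t. -/
lemma pr_const_mul {γ : DiffFun} (hγ : D γ = 0) (Q α : DiffFun) :
    pr (γ * Q) α = γ * pr Q α := by
  obtain ⟨n, f, h⟩ := VF.der_eq_fderiv α
  refine Subtype.ext (funext fun a => ?_)
  show ((vfPr (γ * Q)).der α).1 a = γ.1 a • ((vfPr Q).der α).1 a
  rw [h, h, ← map_smul]
  congr 1
  refine Prod.ext (by simp [trunc, VF.at, vfPr]) (Prod.ext (by simp [trunc, VF.at, vfPr])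
    (funext fun i => ?_))
  simp [trunc, VF.at, vfPr, iterate_D_mul_of_const hγ]

lemma pr_smul (r : ℝ) (Q α : DiffFun) : pr (r • Q) α = r • pr Q α := by
  have := pr_const_mul (γ := algebraMap ℝ DiffFun r) (D.map_algebraMap r) Q α
  rwa [← Algebra.smul_def, ← Algebra.smul_def] at this

@[simp] lemma pr_zero (α : DiffFun) : pr 0 α = 0 := by
  simpa using pr_smul 0 0 α

/-- `∂/∂u_{kx}` annihilates differential functions of order below `k`. -/
lemma du_eq_zero {F : Jet → ℝ} {α : DiffFun} (h : Agrees F α) {n : ℕ} (hF : HasOrderLE n F)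
    {k : ℕ} (hk : max n 3 < k) : du k α = 0 := by
  obtain ⟨f, hf⟩ := hF.exists_isRep (le_max_right n 3) (le_max_left n 3)
  refine Subtype.ext (funext fun a => ?_)
  have h1 := h.along (vfU k) a
  rw [hf.along a.2] at h1
  refine h1.symm.trans ?_
  have : trunc (max n 3) ((vfU k).at a) = 0 := by
    refine Prod.ext rfl (Prod.ext rfl (funext fun i => ?_))
    have hi : (i : ℕ) ≠ k := by have := i.2; omega
    simp [trunc, VF.at, vfU, hi]
  rw [this]
  exact map_zero _

/-! ### Comparison with the operators on functions -/

lemma Agrees.dx {F : Jet → ℝ} {α : DiffFun} (h : Agrees F α) : Agrees (Dx F) (D α) := by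
  intro a ha
  rw [Dx_eq_along]
  exact h.along vfD ⟨a, ha⟩

lemma Agrees.iterate_dx {F : Jet → ℝ} {α : DiffFun} (h : Agrees F α) (k : ℕ) :
    Agrees (Dx^[k] F) (D^[k] α) := by
  induction k with
  | zero => exact h
  | succ k ih => simpa only [Function.iterate_succ_apply'] using ih.dx

lemma Agrees.frechet {E V : Jet → ℝ} {e v : DiffFun} (hE : Agrees E e) (hV : Agrees V v) :
    Agrees (frechet E V) (pr v e) := by
  intro a ha
  rw [frechet_eq_along]
  have : (⟨0, 0, fun k => Dx^[k] V a⟩ : Jet) = (vfPr v).at ⟨a, ha⟩ := by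
    simp only [VF.at, vfPr]
    congr 1
    exact funext fun k => hV.iterate_dx k a ha
  rw [this]
  exact hE.along _ ⟨a, ha⟩

lemma Agrees.partialT {F : Jet → ℝ} {α : DiffFun} (h : Agrees F α) : Agrees (partialT F) (dt α) := by
  intro a ha
  rw [partialT_eq_along]
  exact h.along vfT ⟨a, ha⟩

lemma Agrees.partialU {F : Jet → ℝ} {α : DiffFun} (h : Agrees F α) (k : ℕ) :
    Agrees (partialU k F) (du k α) := by
  intro a ha
  rw [partialU_eq_along]
  refine Eq.trans ?_ (h.along (vfU k) ⟨a, ha⟩)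
  congr 1
  simp only [VF.at, vfU]
  congr 1
  funext l
  rw [Pi.single_apply, Pi.single_apply]
  split_ifs <;> rfl

/-- The operator `L` of the evolution equation `u_t = e`. -/
def linearized (e q : DiffFun) : DiffFun := dt q + pr e q - pr q e

lemma Agrees.linOp {E Q : Jet → ℝ} {e q : DiffFun} (hE : Agrees E e) (hQ : Agrees Q q) :
    Agrees (linOp E Q) (linearized e q) := by
  intro a ha
  simp only [SchwarzianFlow.linOp, Dt]
  rw [hQ.partialT a ha, hQ.frechet hE a ha, hE.frechet hQ a ha]
  rfl

/-! ### The Schwarzian derivative -/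

lemma exists_inv (α : DiffFun) (h : ∀ a, α.1 a ≠ 0) : ∃ β : DiffFun, ∀ a, β.1 a = (α.1 a)⁻¹ :=
  exists_smooth_comp_one α (O := {0}ᶜ) isOpen_compl_singleton
    (fun _ hx => (contDiffAt_inv ℝ hx).contDiffWithinAt) h

/-- `1 / u_x`. -/
def invUx : DiffFun := (exists_inv (coordU 1) fun a => a.2.1).choose

lemma invUx_apply (a : dom) : invUx.1 a = (a.1.u 1)⁻¹ :=
  (exists_inv (coordU 1) fun a => a.2.1).choose_spec a

lemma coordU_mul_invUx : coordU 1 * invUx = 1 := Subtype.ext (funext fun a => by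
  show a.1.u 1 * invUx.1 a = 1
  rw [invUx_apply, mul_inv_cancel₀ a.2.1])

/-- The Schwarzian derivative as an element of the algebra. -/
def sch : DiffFun := coordU 3 * invUx - (3 / 2 : ℝ) • (coordU 2 * invUx) ^ 2

lemma agrees_S : Agrees S sch := by
  intro a ha
  show S a = a.u 3 * invUx.1 ⟨a, ha⟩ - (3 / 2 : ℝ) * (a.u 2 * invUx.1 ⟨a, ha⟩) ^ 2
  rw [invUx_apply]
  simp only [S]
  ring

lemma sch_apply (a : dom) : sch.1 a = S a := (agrees_S a a.2).symm

lemma exists_inv_sqrt : ∃ β : DiffFun, ∀ a, β.1 a = (√(sch.1 a))⁻¹ :=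
  exists_smooth_comp_one sch (ψ := fun y => (√y)⁻¹) (O := Set.Ioi 0) isOpen_Ioi
    (fun _ hx => ((Real.contDiffAt_sqrt (ne_of_gt hx)).inv
      (Real.sqrt_pos.2 hx).ne').contDiffWithinAt)
    (fun a => by rw [sch_apply]; exact a.2.2)

/-- `S^{-1/2}`. -/
def rs : DiffFun := exists_inv_sqrt.choose

lemma rs_apply (a : dom) : rs.1 a = (√(S a))⁻¹ := by
  rw [← sch_apply]; exact exists_inv_sqrt.choose_spec a

lemma rs_mul_rs_mul_sch : rs * rs * sch = 1 := Subtype.ext (funext fun a => by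
  show rs.1 a * rs.1 a * sch.1 a = 1
  have h := a.2.2
  rw [rs_apply, sch_apply, ← mul_inv, Real.mul_self_sqrt h.le, inv_mul_cancel₀ h.ne'])

lemma agrees_Sx (k : ℕ) : Agrees (Sx k) (D^[k] sch) := agrees_S.iterate_dx k

end

/-! ### Differential algebra of the Dym hierarchy -/

section DifferentialAlgebra

variable {A : Type*} [CommRing A] [Algebra ℝ A] (d : Derivation ℝ A A)

lemma derivation_two : d (2 : A) = 0 := by exact_mod_cast d.map_natCast 2

/-- The operator `2 S d + d S`. -/
def J2 (S f : A) : A := 2 * S * d f + d S * f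

/-- The Lie bracket of `f d` and `g d`. -/
def br (f g : A) : A := f * d g - d f * g

/-- Half the linearization of `b ↦ 2 S b² - z (2 b b'' - b'²)`. -/
def bil (S z b c : A) : A := 2 * S * b * c - z * (b * d (d c) + c * d (d b) - d b * d c)

variable {d}

lemma J2_add (S f g : A) : J2 d S (f + g) = J2 d S f + J2 d S g := by
  simp only [J2, map_add]; ring

lemma J2_smul (S : A) (r : ℝ) (f : A) : J2 d S (r • f) = r • J2 d S f := by
  simp only [J2, d.map_smul]
  simp only [Algebra.smul_def]; ring

lemma derivation_J2 {e : Derivation ℝ A A} (he : ∀ f, e (d f) = d (e f)) (S f : A) :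
    e (J2 d S f) = J2 d S (e f) + (2 * e S * d f + d (e S) * f) := by
  simp only [J2, map_add, Derivation.leibniz, smul_eq_mul, derivation_two, he]
  ring

/-- Applying e to the quadratic equation ties the variation of b to that of S. -/
lemma bil_derivation {e : Derivation ℝ A A} (he : ∀ f, e (d f) = d (e f)) {S z b : A}
    (hz : e z = 0) (hb : 2 * S * b ^ 2 - z * (2 * b * d (d b) - d b ^ 2) = 2) :
    2 * bil d S z b (e b) = - (2 * (b ^ 2 * e S)) := by
  have h := congrArg e hb
  simp only [pow_two, map_sub, Derivation.leibniz, smul_eq_mul, derivation_two, he, hz] at h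
  simp only [bil]
  linear_combination h

/-- Invariance under an infinitesimal change of variable f d: when b moves by -[b, f] and S by J f -
z f''', as a projective connection does, the quadratic expression is merely transported, and it is
constant. -/
lemma bil_br {S z b : A} (hb : b * (2 * S * d b + d S * b) = b * (z * d (d (d b))))
    (f : A) : bil d S z b (br d b f) = b ^ 2 * (J2 d S f - z * d (d (d f))) := by
  simp only [bil, br, J2, map_add, map_sub, Derivation.leibniz, smul_eq_mul]
  linear_combination (-f) * hb

/-- The derivative of `bil` is c (J b - z b''') + b (J c - z c'''). The first bracket is only known
to vanish after multiplication by b, hence the extra factor. -/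
lemma derivation_bil {S z b : A} (hz : d z = 0)
    (hb : b * (2 * S * d b + d S * b) = b * (z * d (d (d b)))) (c : A) :
    d (bil d S z b c) * b  = b * (b * (J2 d S c - z * d (d (d c)))) := by
  simp only [bil, J2, map_add, map_sub, Derivation.leibniz, smul_eq_mul, derivation_two, hz]
  linear_combination c * hb

/-- The cocycle identity. -/
lemma br_cocycle (f g : A) : d (d (d (br d f g))) =
    (2 * d f * d (d (d g)) + f * d (d (d (d g)))) -
      (2 * d g * d (d (d f)) + g * d (d (d (d f)))) := by
  simp only [br, map_add, map_sub, Derivation.leibniz, smul_eq_mul]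
  ring

/-- Here x stands for differentiation along the flow and y for the remaining part of `ad`, with x -
y = `ad`. What is left of hx after subtracting hyg and the third derivative of hy is (1 + z) times
`br_cocycle` for b and g. -/
lemma commute_of_relations {S z b g xS xf xg yf yg : A} (hz : d z = 0)
    (hxS : xS = (1 + z) * d (d (d b)))
    (hx : J2 d S xg + (2 * xS * d g + d xS * g) = d (d (d xf)))
    (hyg : J2 d S yg - z * d (d (d yg)) =
      -((1 + z) * (2 * d b * d (d (d g)) + b * d (d (d (d g))))))
    (hy : z * yg = yf + (1 + z) * br d b g) :
    J2 d S (xg - yg) = d (d (d (xf - yf))) := by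
  have h3 := congrArg (fun w => d (d (d w))) hy
  have hz1 : d (1 + z) = 0 := by simp [hz]
  simp only [map_add, Derivation.leibniz, smul_eq_mul, hz, hz1] at h3
  have hc := br_cocycle (d := d) b g
  simp only [J2, map_sub] at *
  rw [hxS] at hx
  simp only [Derivation.leibniz, smul_eq_mul, hz1] at hx
  simp only [mul_zero, add_zero, map_zero] at h3 hx
  linear_combination hx - hyg - h3 - (1 + z) * hc

end DifferentialAlgebra

/-! ### Formal power series over a differential algebra -/

section Series

open PowerSeries

variable {A : Type*} [CommRing A] [Algebra ℝ A]

/-- Coefficientwise extension of a derivation to power series. -/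
def lift (d : Derivation ℝ A A) : Derivation ℝ A⟦X⟧ A⟦X⟧ :=
  Derivation.mk'
    { toFun := fun f => PowerSeries.mk fun n => d (coeff n f)
      map_add' := fun f g => by ext n; simp
      map_smul' := fun r f => by ext n; simp }
    fun f g => by
      ext n
      simp only [LinearMap.coe_mk, AddHom.coe_mk, coeff_mk, coeff_mul, map_sum, map_add,
        smul_eq_mul, Derivation.leibniz, Finset.sum_add_distrib]
      congr 1
      rw [← Finset.Nat.sum_antidiagonal_swap]
      rfl

@[simp] lemma coeff_lift (d : Derivation ℝ A A) (f : A⟦X⟧) (n : ℕ) :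
    coeff n (lift d f) = d (coeff n f) := by
  show coeff n (PowerSeries.mk fun n => d (coeff n f)) = _
  rw [coeff_mk]

@[simp] lemma lift_X (d : Derivation ℝ A A) : lift d (X : A⟦X⟧) = 0 := by
  ext n
  rw [coeff_lift, coeff_X]
  split_ifs <;> simp

@[simp] lemma lift_C (d : Derivation ℝ A A) (a : A) : lift d (C a) = C (d a) := by
  ext n
  rw [coeff_lift, coeff_C, coeff_C]
  split_ifs <;> simp

lemma lift_comm {d e : Derivation ℝ A A} (h : ∀ f, e (d f) = d (e f)) (f : A⟦X⟧) :
    lift e (lift d f) = lift d (lift e f) := by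
  ext n; simp [h]

lemma coeff_J2 (d : Derivation ℝ A A) (S : A) (f : A⟦X⟧) (n : ℕ) :
    coeff n (J2 (lift d) (C S) f) = J2 d S (coeff n f) := by
  have h2 : (2 : A⟦X⟧) = C (2 : A) := (map_ofNat C 2).symm
  rw [J2, J2, lift_C, h2, ← map_mul, map_add, coeff_C_mul, coeff_C_mul, coeff_lift]

/-- Modulo X the operator is multiplication by the unit 2 S b_0. Powers of X are constants for `lift
d`, so they can be divided out one after another and every X^n divides c. -/
lemma bil_lift_injective (d : Derivation ℝ A A) {S : A} {b : A⟦X⟧}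
    (hu : IsUnit (2 * S * coeff 0 b)) {c : A⟦X⟧} (hc : bil (lift d) (C S) X b c = 0) : c = 0 := by
  have key : ∀ n, (X : A⟦X⟧) ^ n ∣ c := by
    intro n
    induction n with
    | zero => simp
    | succ n ih =>
      obtain ⟨e, rfl⟩ := ih
      have hX : ∀ f : A⟦X⟧, lift d (X ^ n * f) = X ^ n * lift d f := by
        intro f
        rw [Derivation.leibniz, Derivation.leibniz_pow, lift_X]
        simp
      have h1 : (X : A⟦X⟧) ^ n * bil (lift d) (C S) X b e = 0 := by
        rw [← hc]
        simp only [bil, hX]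
        ring
      have h2 : bil (lift d) (C S) X b e = 0 := by
        ext m
        have := congrArg (coeff (m + n)) h1
        rwa [coeff_X_pow_mul] at this
      have h3 := congrArg (coeff 0) h2
      have h4 : (2 : A⟦X⟧) = C (2 : A) := (map_ofNat C 2).symm
      rw [bil, map_sub, coeff_zero_X_mul, sub_zero, h4] at h3
      simp only [coeff_zero_eq_constantCoeff, map_mul, constantCoeff_C, map_zero] at h3 hu
      have h5 : constantCoeff e = 0 := (hu.mul_right_eq_zero).1 h3
      rw [pow_succ]
      exact mul_dvd_mul_left _ (X_dvd_iff.2 h5)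
  ext n
  simpa using X_pow_dvd_iff.1 (key (n + 1)) n (by omega)

/-- The coefficients of the solution of `2 S b² - z (2 b b'' - b'²) = 2` with leading
coefficient `r = S^{-1/2}`. -/
def dymCoeff (d : Derivation ℝ A A) (S r : A) : ℕ → A
  | 0 => r
  | n + 1 => (1 / 4 : ℝ) • (r * ((∑ i : Fin (n + 1),
      (2 * dymCoeff d S r i * d (d (dymCoeff d S r (n - i))) -
        d (dymCoeff d S r i) * d (dymCoeff d S r (n - i)))) -
      2 * S * ∑ i : Fin n, dymCoeff d S r (i + 1) * dymCoeff d S r (n - i)))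
  decreasing_by all_goals omega

/-- The generating series of the Dym hierarchy. -/
def dymSeries (d : Derivation ℝ A A) (S r : A) : A⟦X⟧ := PowerSeries.mk (dymCoeff d S r)

lemma dymSeries_eq (d : Derivation ℝ A A) {S r : A} (hr : r * r * S = 1) :
    2 * C S * dymSeries d S r ^ 2 - X * (2 * dymSeries d S r * lift d (lift d (dymSeries d S r)) -
      lift d (dymSeries d S r) ^ 2) = 2 := by
  have h2 : (2 : A⟦X⟧) = C (2 : A) := (map_ofNat C 2).symm
  rw [h2]
  have h4 : algebraMap ℝ A (1 / 4) * 4 = 1 := by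
    rw [← map_ofNat (algebraMap ℝ A) 4, ← map_mul]; norm_num
  ext n
  rcases n with _ | n
  · rw [map_sub, coeff_zero_X_mul, ← map_mul, coeff_C_mul, coeff_zero_C, pow_two, coeff_mul]
    simp only [dymSeries, coeff_mk, Finset.Nat.antidiagonal_zero, Finset.sum_singleton]
    rw [dymCoeff.eq_1]
    linear_combination 2 * hr
  · rw [map_sub, coeff_succ_X_mul, ← map_mul, coeff_C_mul, map_sub, pow_two, pow_two,
      mul_assoc (C 2), coeff_C_mul, coeff_mul, coeff_mul, coeff_mul, coeff_C, if_neg n.succ_ne_zero]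
    simp only [coeff_lift, dymSeries, coeff_mk, Finset.Nat.sum_antidiagonal_eq_sum_range_succ_mk]
    -- The unknown b_{n+1} appears in the convolution b² only in the first and last terms, each time
    -- multiplied by r. Peeling them off leaves the sum used in `dymCoeff`; the factor r/4 there is
    -- 1/(4 S r).
    rw [Finset.sum_range_succ, Finset.sum_range_succ']
    have hn := dymCoeff.eq_2 d S r n
    rw [Fin.sum_univ_eq_sum_range (fun i => 2 * dymCoeff d S r i * d (d (dymCoeff d S r (n - i))) -
        d (dymCoeff d S r i) * d (dymCoeff d S r (n - i))) (n + 1),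
      Fin.sum_univ_eq_sum_range (fun i => dymCoeff d S r (i + 1) * dymCoeff d S r (n - i)) n,
      Finset.sum_sub_distrib] at hn
    simp only [mul_assoc, ← Finset.mul_sum] at hn
    simp only [Nat.sub_zero, Nat.sub_self, Nat.add_sub_add_right]
    have h0 : dymCoeff d S r 0 = r := dymCoeff.eq_1 d S r
    rw [hn, h0, Algebra.smul_def]
    generalize (∑ i ∈ Finset.range n, dymCoeff d S r (i + 1) * dymCoeff d S r (n - i)) = s1
    generalize (∑ i ∈ Finset.range (n + 1), dymCoeff d S r i * d (d (dymCoeff d S r (n - i)))) = s2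
    generalize (∑ i ∈ Finset.range (n + 1), d (dymCoeff d S r i) * d (dymCoeff d S r (n - i))) = s3
    linear_combination (2 * s2 - s3 - 2 * S * s1) * (4 * algebraMap ℝ A (1 / 4) * hr + h4)

end Series

section

open PowerSeries

/-! ### Evolutionary derivatives of the Schwarzian -/

/-- The adjoint action of the flow `u_t = u_x b` on `u_x f`, divided by `u_x`. -/
def ad (b f : DiffFun) : DiffFun :=
  pr (coordU 1 * b) f - br D b f - pr (coordU 1 * f) b

/-- `u_{xx} / u_x`. -/
def preSch : DiffFun := coordU 2 * invUx

lemma coordU_two : coordU 2 = coordU 1 * preSch := by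
  rw [preSch]
  linear_combination (-coordU 2) * coordU_mul_invUx

lemma derivation_invUx (e : Derivation ℝ DiffFun DiffFun) :
    e invUx = - invUx ^ 2 * e (coordU 1) := by
  have h := congrArg e coordU_mul_invUx
  rw [Derivation.leibniz, Derivation.map_one_eq_zero, smul_eq_mul, smul_eq_mul] at h
  linear_combination invUx * h - e invUx * coordU_mul_invUx

lemma D_coordU_one_mul (f : DiffFun) :
    D (coordU 1 * f) = coordU 1 * (D f + preSch * f) := by
  rw [Derivation.leibniz, D_coordU, smul_eq_mul, smul_eq_mul, coordU_two]
  ring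

lemma two_half : (2 : DiffFun) * algebraMap ℝ DiffFun (1 / 2) = 1 := by
  rw [← map_ofNat (algebraMap ℝ DiffFun) 2, ← map_mul]; norm_num

lemma sch_eq : sch = D preSch - (1 / 2 : ℝ) • preSch ^ 2 := by
  have h : (3 / 2 : ℝ) = 1 + 1 / 2 := by norm_num
  rw [preSch, Derivation.leibniz, D_coordU, derivation_invUx, D_coordU, sch, h, add_smul, one_smul]
  simp only [smul_eq_mul]
  ring

/-- `preSch` is the total derivative of log |u_x|, and log |u_x| varies by D(u_x f)/u_x = f' +
`preSch` f. -/
lemma pr_preSch (f : DiffFun) : pr (coordU 1 * f) preSch = D (D f + preSch * f) := by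
  have h1 : pr (coordU 1 * f) (coordU 1) = coordU 1 * (D f + preSch * f) := by
    rw [pr_coordU, Function.iterate_one, D_coordU_one_mul]
  have h2 : pr (coordU 1 * f) (coordU 2) =
      coordU 1 * (D (D f + preSch * f) + preSch * (D f + preSch * f)) := by
    rw [pr_coordU, Function.iterate_succ_apply, Function.iterate_one, D_coordU_one_mul,
      D_coordU_one_mul]
  rw [preSch, Derivation.leibniz, derivation_invUx, smul_eq_mul, smul_eq_mul, h1, h2, ← preSch]
  rw [coordU_two]
  linear_combination (D (D f + preSch * f) + preSch * (D f + preSch * f)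
    - preSch * (D f + preSch * f) * (coordU 1 * invUx + 1)) * coordU_mul_invUx

/-- Varying S = p' - p²/2 with p = `preSch`, all terms in p recombine into S. The result is the
infinitesimal action of vector fields on projective connections. -/
lemma pr_sch (f : DiffFun) : pr (coordU 1 * f) sch = D (D (D f)) + J2 D sch f := by
  have h : pr (coordU 1 * f) sch = D (D (D f + preSch * f)) - preSch * D (D f + preSch * f) := by
    rw [sch_eq, map_sub, pr_D, pr_preSch, Derivation.map_smul, pow_two, Derivation.leibniz,
      pr_preSch, smul_eq_mul, Algebra.smul_def]
    linear_combination (-(preSch * D (D f + preSch * f))) * two_half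
  rw [h, J2, sch_eq]
  simp only [map_add, map_sub, Derivation.map_smul, Derivation.leibniz, smul_eq_mul, pow_two]
  simp only [Algebra.smul_def]
  linear_combination (preSch ^ 2 * D f + preSch * D preSch * f) * two_half

lemma linearized_mul (b f : DiffFun) :
    linearized (coordU 1 * b) (coordU 1 * f) = coordU 1 * (dt f + ad b f) := by
  rw [linearized, ad, br]
  simp only [Derivation.leibniz, smul_eq_mul, dt_coordU, pr_coordU, Function.iterate_one, D_coordU]
  ring

lemma dt_sch : dt sch = 0 := by
  simp [sch, Derivation.leibniz, derivation_invUx, Derivation.leibniz_pow]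

/-! ### The basic hierarchy -/

/-- The basic hierarchy, with `2 S b_{n+1}' + S' b_{n+1} = b_n'''` and `b_0 = S^{-1/2}`. -/
def dym (n : ℕ) : DiffFun := dymCoeff D sch rs n

/-- The generating series of the basic hierarchy. -/
def dymGen : DiffFun⟦X⟧ := dymSeries D sch rs

@[simp] lemma coeff_dymGen (n : ℕ) : coeff n dymGen = dym n := coeff_mk _ _

lemma dym_zero : dym 0 = rs := dymCoeff.eq_1 _ _ _

lemma isUnit_two {B : Type*} [CommRing B] [Algebra ℝ B] : IsUnit (2 : B) := by
  rw [← map_ofNat (algebraMap ℝ B) 2]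
  exact (isUnit_iff_ne_zero.2 two_ne_zero).map _

lemma isUnit_rs : IsUnit rs := IsUnit.of_mul_eq_one (rs * sch) (by rw [← mul_assoc]; exact rs_mul_rs_mul_sch)

lemma isUnit_sch : IsUnit sch := IsUnit.of_mul_eq_one (rs * rs) (by rw [mul_comm]; exact rs_mul_rs_mul_sch)

lemma isUnit_dymGen : IsUnit dymGen := by
  rw [PowerSeries.isUnit_iff_constantCoeff, ← coeff_zero_eq_constantCoeff_apply, coeff_dymGen,
    dym_zero]
  exact isUnit_rs

lemma dymGen_eq : 2 * C sch * dymGen ^ 2 -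
    X * (2 * dymGen * lift D (lift D dymGen) - lift D dymGen ^ 2) = 2 :=
  dymSeries_eq D rs_mul_rs_mul_sch

/-- The derivative of the quadratic equation is 2B (J B - z B'''), and both 2 and B are units. -/
lemma J2_dymGen : J2 (lift D) (C sch) dymGen = X * lift D (lift D (lift D dymGen)) := by
  have h := congrArg (lift D) dymGen_eq
  simp only [pow_two, map_sub, Derivation.leibniz, smul_eq_mul, derivation_two, lift_X] at h
  refine isUnit_two.mul_left_cancel (isUnit_dymGen.mul_left_cancel ?_)
  rw [J2]
  linear_combination h

lemma dymGen_mul_J2 : dymGen * (2 * C sch * lift D dymGen + lift D (C sch) * dymGen) =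
    dymGen * (X * lift D (lift D (lift D dymGen))) := by
  rw [← J2_dymGen, J2]

lemma J2_dym_zero : J2 D sch (dym 0) = 0 := by
  have := congrArg (coeff 0) J2_dymGen
  rwa [coeff_J2, coeff_zero_X_mul, coeff_dymGen] at this

lemma J2_dym_succ (n : ℕ) : J2 D sch (dym (n + 1)) = D (D (D (dym n))) := by
  have := congrArg (coeff (n + 1)) J2_dymGen
  rwa [coeff_J2, coeff_succ_X_mul, coeff_dymGen, coeff_lift, coeff_lift, coeff_lift,
    coeff_dymGen] at this

lemma bil_dymGen_injective {c : DiffFun⟦X⟧} (hc : bil (lift D) (C sch) X dymGen c = 0) : c = 0 := by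
  refine bil_lift_injective D ?_ hc
  rw [coeff_dymGen, dym_zero]
  exact (isUnit_two.mul isUnit_sch).mul isUnit_rs

lemma bil_lift_dymGen {e : Derivation ℝ DiffFun DiffFun} (he : ∀ f, e (D f) = D (e f)) :
    bil (lift D) (C sch) X dymGen (lift e dymGen) = -(dymGen ^ 2 * C (e sch)) := by
  refine isUnit_two.mul_left_cancel ?_
  rw [bil_derivation (lift_comm he) (lift_X e) dymGen_eq, lift_C]
  ring

lemma bil_br_dymGen (f : DiffFun⟦X⟧) : bil (lift D) (C sch) X dymGen (br (lift D) dymGen f) =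
    dymGen ^ 2 * (J2 (lift D) (C sch) f - X * lift D (lift D (lift D f))) :=
  bil_br dymGen_mul_J2 f

/-- S has no explicit t, so the variation of B under ∂/∂t lies in the kernel of an injective map. -/
lemma dt_dym (n : ℕ) : dt (dym n) = 0 := by
  have h : lift dt dymGen = 0 := bil_dymGen_injective (by
    rw [bil_lift_dymGen dt_D, dt_sch]; simp)
  have := congrArg (coeff n) h
  rwa [coeff_lift, coeff_dymGen, map_zero] at this

/-! ### Adjoint action of the basic flows -/

/-- The generating series of the parts of `ad (dym n) f` of the form `[dym n, f] + pr (u_x f) (dym n)`. -/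
def adSeries (f : DiffFun) : DiffFun⟦X⟧ :=
  br (lift D) dymGen (C f) + lift (pr (coordU 1 * f)) dymGen

/-- The generating series of the evolutionary derivatives of `f` along the basic hierarchy. -/
def prSeries (f : DiffFun) : DiffFun⟦X⟧ := PowerSeries.mk fun n => pr (coordU 1 * dym n) f

@[simp] lemma coeff_prSeries (n : ℕ) (f : DiffFun) :
    coeff n (prSeries f) = pr (coordU 1 * dym n) f := coeff_mk _ _

lemma coeff_br_C_right (n : ℕ) (g : DiffFun⟦X⟧) (f : DiffFun) :
    coeff n (br (lift D) g (C f)) = br D (coeff n g) f := by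
  rw [br, br, lift_C, map_sub, coeff_mul_C, coeff_mul_C, coeff_lift]

lemma coeff_ad (n : ℕ) (f : DiffFun) :
    coeff n (prSeries f - adSeries f) = ad (dym n) f := by
  rw [ad, adSeries, map_sub, map_add, coeff_prSeries, coeff_br_C_right, coeff_lift, coeff_dymGen]
  ring

lemma J2_C (f : DiffFun) : J2 (lift D) (C sch) (C f) = C (J2 D sch f) := by
  rw [J2, J2, lift_C, lift_C, map_add, map_mul, map_mul, map_mul, map_ofNat]

/-- J f from the bracket cancels against J f in the variation of S, so only f''' survives. -/
lemma bil_adSeries (f : DiffFun) : bil (lift D) (C sch) X dymGen (adSeries f) =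
    -((1 + X) * (dymGen ^ 2 * C (D (D (D f))))) := by
  have h1 := bil_br_dymGen (C f)
  have h2 := bil_lift_dymGen (pr_D (coordU 1 * f))
  rw [pr_sch, map_add, ← J2_C] at h2
  simp only [lift_C] at h1
  have hadd : ∀ c c', bil (lift D) (C sch) X dymGen (c + c') =
      bil (lift D) (C sch) X dymGen c + bil (lift D) (C sch) X dymGen c' := by
    intro c c'; simp only [bil, map_add]; ring
  rw [adSeries, hadd, h1, h2, J2_C]
  ring

/-- Differentiate `bil_adSeries`, rewrite the left side by `derivation_bil` and cancel B twice. -/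
lemma J2_adSeries (f : DiffFun) :
    J2 (lift D) (C sch) (adSeries f) - X * lift D (lift D (lift D (adSeries f))) =
      -((1 + X) * (2 * lift D dymGen * lift D (lift D (lift D (C f))) +
        dymGen * lift D (lift D (lift D (lift D (C f)))))) := by
  have h := derivation_bil (lift_X D) dymGen_mul_J2 (adSeries f)
  have hX : lift D (1 + X) = 0 := by simp
  rw [bil_adSeries, map_neg, Derivation.leibniz, hX, pow_two, Derivation.leibniz,
    Derivation.leibniz] at h
  simp only [smul_eq_mul] at h
  refine isUnit_dymGen.mul_left_cancel (isUnit_dymGen.mul_left_cancel ?_)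
  simp only [lift_C] at h ⊢
  linear_combination -h

/-- Both sides have the same image under the injective linearization: in the bracket term J g is
replaced by f''', which cancels the contribution of f. -/
lemma X_mul_adSeries {f g : DiffFun} (h : J2 D sch g = D (D (D f))) :
    X * adSeries g = adSeries f + (1 + X) * br (lift D) dymGen (C g) := by
  rw [← sub_eq_zero]
  refine bil_dymGen_injective ?_
  have hlin : ∀ c c' c'', bil (lift D) (C sch) X dymGen (X * c - (c' + (1 + X) * c'')) =
      X * bil (lift D) (C sch) X dymGen c - (bil (lift D) (C sch) X dymGen c' +
        (1 + X) * bil (lift D) (C sch) X dymGen c'') := by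
    intro c c' c''
    have hX : lift D (1 + X) = 0 := by simp
    simp only [bil, map_sub, map_add (lift D) c', Derivation.leibniz, hX, lift_X, smul_eq_mul]
    simp only [mul_zero, add_zero, Derivation.leibniz, hX, lift_X, smul_eq_mul,
      map_add (lift D) (lift D c')]
    ring
  rw [hlin, bil_adSeries, bil_adSeries, bil_br_dymGen, J2_C, h]
  simp only [lift_C]
  ring

/-- The adjoint action of the basic flows preserves the relation `2 S g' + S' g = f'''`. -/
theorem J2_ad_dym {f g : DiffFun} (h : J2 D sch g = D (D (D f))) (n : ℕ) :
    J2 D sch (ad (dym n) g) = D (D (D (ad (dym n) f))) := by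
  -- Along u_t = u_x B the Schwarzian varies by B''' + J B, and J B = z B'''.
  have hS : prSeries sch = (1 + X) * lift D (lift D (lift D dymGen)) := by
    have : prSeries sch = lift D (lift D (lift D dymGen)) + J2 (lift D) (C sch) dymGen := by
      ext m
      rw [coeff_prSeries, pr_sch, map_add, coeff_J2]
      simp
    rw [this, J2_dymGen]
    ring
  have hx : J2 (lift D) (C sch) (prSeries g) + (2 * prSeries sch * lift D (C g) +
      lift D (prSeries sch) * C g) = lift D (lift D (lift D (prSeries f))) := by
    have h2 : (2 : DiffFun⟦X⟧) = C (2 : DiffFun) := (map_ofNat C 2).symm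
    refine PowerSeries.ext fun m => ?_
    have h1 := congrArg (pr (coordU 1 * dym m)) h
    rw [derivation_J2 (pr_D _), pr_D, pr_D, pr_D] at h1
    rw [map_add, coeff_J2, h2, lift_C, mul_assoc, map_add, coeff_C_mul, coeff_mul_C, coeff_mul_C,
      coeff_lift, coeff_lift, coeff_lift, coeff_lift, coeff_prSeries, coeff_prSeries,
      coeff_prSeries, ← h1]
    ring
  have := commute_of_relations (lift_X D) hS hx (J2_adSeries g) (X_mul_adSeries h)
  have h3 := congrArg (coeff n) this
  rwa [coeff_J2, coeff_lift, coeff_lift, coeff_lift, coeff_ad, coeff_ad] at h3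

/-- With J g = f''', the variation of S along f minus z times that along g is J(f + g) - z (f +
g)'''. This is the change of S under the change of variable f + g, so B changes by -[B, f + g]. -/
lemma pr_dymGen {f g : DiffFun} (h : J2 D sch g = D (D (D f))) :
    lift (pr (coordU 1 * f)) dymGen - X * lift (pr (coordU 1 * g)) dymGen =
      -br (lift D) dymGen (C (g + f)) := by
  rw [← sub_eq_zero]
  refine bil_dymGen_injective ?_
  have hlin : ∀ c c' c'', bil (lift D) (C sch) X dymGen (c - X * c' - -c'') =
      bil (lift D) (C sch) X dymGen c - X * bil (lift D) (C sch) X dymGen c' +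
        bil (lift D) (C sch) X dymGen c'' := by
    intro c c' c''
    simp only [bil, map_sub, map_neg, Derivation.leibniz, lift_X, smul_eq_mul, mul_zero, add_zero]
    ring
  rw [hlin, bil_br_dymGen, bil_lift_dymGen (pr_D _), bil_lift_dymGen (pr_D _), J2_C, J2_add,
    pr_sch, pr_sch, h]
  simp only [lift_C, map_add]
  ring

lemma pr_dym_zero {f g : DiffFun} (h : J2 D sch g = D (D (D f))) :
    pr (coordU 1 * f) (dym 0) = -br D (dym 0) (g + f) := by
  have := congrArg (coeff 0) (pr_dymGen h)
  rwa [map_sub, coeff_zero_X_mul, sub_zero, coeff_lift, map_neg, coeff_br_C_right,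
    coeff_dymGen] at this

lemma pr_dym_succ {f g : DiffFun} (h : J2 D sch g = D (D (D f))) (n : ℕ) :
    pr (coordU 1 * f) (dym (n + 1)) - pr (coordU 1 * g) (dym n) =
      -br D (dym (n + 1)) (g + f) := by
  have := congrArg (coeff (n + 1)) (pr_dymGen h)
  rwa [map_sub, coeff_succ_X_mul, coeff_lift, coeff_lift, map_neg, coeff_br_C_right,
    coeff_dymGen, coeff_dymGen] at this

/-- The basic flows commute. -/
theorem ad_dym_dym (i j : ℕ) : ad (dym i) (dym j) = 0 := by
  induction i generalizing j with
  | zero =>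
    -- Since J b_0 = 0, the pair (0, b_0) satisfies the relation: zero plays the role of b_{-1}.
    have h1 := pr_dym_succ (f := 0) (g := dym 0) (by rw [J2_dym_zero]; simp) j
    have h2 := pr_dym_zero (J2_dym_succ j)
    rw [mul_zero, pr_zero] at h1
    simp only [ad, br, map_add, add_zero] at *
    linear_combination -h1 - h2
  | succ i ih =>
    -- The two index shifts together give ad b_{i+1} b_j = ad b_i b_{j+1}, which lowers i.
    have h0 := ih (j + 1)
    have h1 := pr_dym_succ (J2_dym_succ i) j
    have h2 := pr_dym_succ (J2_dym_succ j) i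
    simp only [ad, br, map_add] at *
    linear_combination h0 - h1 - h2

end

section

open Topology Filter

/-! ### The kernel of the total derivative -/

/-- Derivatives in coordinates above the order vanish, and `du_succ_D` passes the vanishing down
from k + 1 to k. -/
lemma du_eq_zero_of_D_eq_zero {α : DiffFun} (h : D α = 0) (k : ℕ) : du k α = 0 := by
  obtain ⟨n, hn⟩ := α.2
  have key : ∀ m k, max n 3 < k + m → du k α = 0 := by
    intro m
    induction m with
    | zero => exact fun k hk => du_eq_zero (agrees_ext α) hn hk
    | succ m ih =>
      intro k hk
      have h1 := du_succ_D k α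
      rwa [h, map_zero, ih (k + 1) (by omega), map_zero, zero_add, eq_comm] at h1
  exact key (max n 3 + 1) k (by omega)

lemma along_of_D_eq_zero {α : DiffFun} (h : D α = 0) (v : Jet) (a : dom) :
    along v (ext α.1) a = v.t * (dt α).1 a := by
  have h1 : ∀ k, partialU k (ext α.1) a = 0 := fun k => by
    rw [(agrees_ext α).partialU k a a.2, du_eq_zero_of_D_eq_zero h]; rfl
  have h2 : Dx (ext α.1) a = 0 := by rw [(agrees_ext α).dx a a.2, h]; rfl
  simp only [Dx, h1, mul_zero, finsum_zero, add_zero] at h2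
  simp only [along, h1, h2, mul_zero, finsum_zero, zero_add, add_zero]
  rw [(agrees_ext α).partialT a a.2]

lemma pr_of_D_eq_zero {α : DiffFun} (h : D α = 0) (Q : DiffFun) : pr Q α = 0 :=
  Subtype.ext (funext fun a => by
    show along ((vfPr Q).at a) (ext α.1) a = 0
    rw [along_of_D_eq_zero h]
    exact zero_mul _)

/-- The form 2 u_x u_{3x} - 3 u_{xx}² has signature (1, 2), so the set where it is positive is a
pair of open convex cones, distinguished by the sign of u_x. `key` is the reversed Cauchy–Schwarz
inequality for two points of one cone. -/
lemma mem_dom_segment {a b : Jet} (ha : a ∈ dom) (hb : b ∈ dom) (hab : 0 < a.u 1 * b.u 1) {y : ℝ}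
    (hy0 : 0 ≤ y) (hy1 : y ≤ 1) (c : Jet) (hc : ∀ k, c.u k = a.u k + y * (b.u k - a.u k)) :
    c ∈ dom := by
  rw [mem_dom] at ha hb ⊢
  rw [hc, hc, hc]
  have key : 3 * (a.u 2 * b.u 2) < a.u 1 * b.u 3 + b.u 1 * a.u 3 := by
    have h1 : 0 < a.u 1 ^ 2 := by
      have : a.u 1 ≠ 0 := fun h => by simp [h] at hab
      positivity
    have h2 : 0 < b.u 1 ^ 2 := by
      have : b.u 1 ≠ 0 := fun h => by simp [h] at hab
      positivity
    have h3 : a.u 1 * b.u 1 * (3 * (a.u 2 * b.u 2)) <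
        a.u 1 * b.u 1 * (a.u 1 * b.u 3 + b.u 1 * a.u 3) := by
      nlinarith [mul_lt_mul_of_pos_left hb h1, mul_lt_mul_of_pos_left ha h2,
        sq_nonneg (a.u 1 * b.u 2 - b.u 1 * a.u 2)]
    exact lt_of_mul_lt_mul_left h3 hab.le
  have e : 2 * ((a.u 1 + y * (b.u 1 - a.u 1)) * (a.u 3 + y * (b.u 3 - a.u 3))) -
      3 * (a.u 2 + y * (b.u 2 - a.u 2)) ^ 2 =
      (1 - y) ^ 2 * (2 * (a.u 1 * a.u 3) - 3 * a.u 2 ^ 2) +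
      y ^ 2 * (2 * (b.u 1 * b.u 3) - 3 * b.u 2 ^ 2) +
      2 * (y * (1 - y)) * (a.u 1 * b.u 3 + b.u 1 * a.u 3 - 3 * (a.u 2 * b.u 2)) := by ring
  have h1 : 0 ≤ y * (1 - y) := mul_nonneg hy0 (by linarith)
  have h2 : 0 ≤ 2 * (y * (1 - y)) * (a.u 1 * b.u 3 + b.u 1 * a.u 3 - 3 * (a.u 2 * b.u 2)) :=
    mul_nonneg (by linarith) (by linarith)
  rcases eq_or_lt_of_le hy0 with rfl | hy
  · simpa using ha
  · have h3 : 0 < y ^ 2 * (2 * (b.u 1 * b.u 3) - 3 * b.u 2 ^ 2) :=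
      mul_pos (by positivity) (by linarith)
    have h4 : 0 ≤ (1 - y) ^ 2 * (2 * (a.u 1 * a.u 3) - 3 * a.u 2 ^ 2) :=
      mul_nonneg (sq_nonneg _) (by linarith)
    linarith

/-- A differential function with zero total derivative depends only on `t` and the sign
of `u_x`. -/
theorem eq_of_D_eq_zero {α : DiffFun} (h : D α = 0) (a b : dom) (ht : a.1.t = b.1.t)
    (hab : 0 < a.1.u 1 * b.1.u 1) : α.1 a = α.1 b := by
  obtain ⟨n, -, f, hf⟩ := exists_rep_of α 0
  let v : Jet := ⟨b.1.x - a.1.x, 0, fun k => b.1.u k - a.1.u k⟩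
  let γ : ℝ → Jet := fun y => ⟨a.1.x + y * v.x, a.1.t, fun k => a.1.u k + y * v.u k⟩
  have hγ : ∀ y, HasDerivAt (fun z => trunc n (γ z)) (trunc n v) y := by
    intro y
    have hlin : ∀ c w : ℝ, HasDerivAt (fun z => c + z * w) w y := fun c w => by
      simpa using ((hasDerivAt_id y).mul_const w).const_add c
    exact (hlin _ _).prodMk ((hasDerivAt_const _ _).prodMk (hasDerivAt_pi.2 fun i => hlin _ _))
  have hmem : ∀ y ∈ Set.Icc (0 : ℝ) 1, γ y ∈ dom := fun y hy =>
    mem_dom_segment a.2 b.2 hab hy.1 hy.2 _ fun k => rfl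
  have hd : ∀ y ∈ Set.Icc (0 : ℝ) 1, HasDerivAt (fun z => ext α.1 (γ z)) 0 y := by
    intro y hy
    have h1 := hf.hasDerivAt (hγ y) (hmem y hy)
    rwa [← hf.along (hmem y hy), along_of_D_eq_zero h v ⟨γ y, hmem y hy⟩,
      show v.t = 0 from rfl, zero_mul] at h1
  have h1 := constant_of_has_deriv_right_zero (f := fun z => ext α.1 (γ z)) (a := 0) (b := 1)
    (fun y hy => (hd y hy).continuousAt.continuousWithinAt)
    (fun y hy => (hd y ⟨hy.1, hy.2.le⟩).hasDerivWithinAt) 1 ⟨zero_le_one, le_rfl⟩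
  have h0 : γ 0 = a := by simp [γ]
  have h2 : γ 1 = b := by simp [γ, v, ht]
  simp only [h0, h2] at h1
  rw [ext_apply _ a.2, ext_apply _ b.2] at h1
  exact h1.symm

/-- The coordinate `t`. -/
def coordT : DiffFun := ⟨fun a => a.1.t,
  (isDiffFun_of_contDiff (n := 0) (f := fun p => p.2.1) (by fun_prop)).congr
    fun a ha => ext_apply _ ha⟩

lemma VF.der_coordT (V : VF) : V.der coordT = V.t :=
  Subtype.ext (funext fun a => VF.der_of_linear (n := 3) le_rfl
    ((ContinuousLinearMap.fst ℝ ℝ _).comp (ContinuousLinearMap.snd ℝ ℝ _)) (fun _ => rfl) V a)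

/-- A jet with `S = 1` and given `t` and `u_x = σ`. -/
def baseJet (σ t : ℝ) : Jet := ⟨0, t, fun k => if k = 1 ∨ k = 3 then σ else 0⟩

lemma baseJet_mem {σ : ℝ} (hσ : σ ≠ 0) (t : ℝ) : baseJet σ t ∈ dom := by
  rw [mem_dom]
  simp only [baseJet]
  norm_num
  positivity

lemma contDiff_baseJet (α : DiffFun) {σ : ℝ} (hσ : σ ≠ 0) :
    ContDiff ℝ ∞ fun t => ext α.1 (baseJet σ t) := by
  obtain ⟨n, -, f, hf⟩ := exists_rep_of α 0
  have h1 : (fun t => ext α.1 (baseJet σ t)) = fun t => f (trunc n (baseJet σ t)) :=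
    funext fun t => hf.eq _ (baseJet_mem hσ t)
  rw [h1, contDiff_iff_contDiffAt]
  intro t
  refine ContDiffAt.comp t
    (hf.smooth.contDiffAt ((isOpen_image hf.le).mem_nhds ⟨_, baseJet_mem hσ t, rfl⟩)) ?_
  exact contDiffAt_const.prodMk (contDiffAt_id.prodMk
    (contDiffAt_const (c := (trunc n (baseJet σ 0)).2.2)))

lemma exists_primitive {c : ℝ → ℝ} (hc : ContDiff ℝ ∞ c) :
    ∃ C : ℝ → ℝ, ContDiff ℝ ∞ C ∧ ∀ t, HasDerivAt C (c t) t := by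
  have h : ∀ t, HasDerivAt (fun s => ∫ y in (0 : ℝ)..s, c y) (c t) t := fun t =>
    intervalIntegral.integral_hasDerivAt_right (hc.continuous.intervalIntegrable _ _)
      (hc.continuous.stronglyMeasurableAtFilter _ _) hc.continuous.continuousAt
  refine ⟨_, ?_, h⟩
  rw [contDiff_infty_iff_deriv]
  refine ⟨fun t => (h t).differentiableAt, ?_⟩
  rwa [show deriv (fun s => ∫ y in (0 : ℝ)..s, c y) = c from funext fun t => (h t).deriv]

/-- On the kernel of the total derivative, `∂/∂t` is onto. -/
theorem exists_dt_primitive {α : DiffFun} (h : D α = 0) : ∃ γ : DiffFun, D γ = 0 ∧ dt γ = α := by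
  obtain ⟨C₁, hC₁, hd₁⟩ := exists_primitive (contDiff_baseJet α one_ne_zero)
  obtain ⟨C₂, hC₂, hd₂⟩ := exists_primitive (contDiff_baseJet α (neg_ne_zero.2 one_ne_zero))
  -- On the two components u_x > 0 and u_x < 0 of `dom`, α may be unrelated functions of t, so each
  -- gets its own primitive.
  let Ψ : (Fin 2 → ℝ) → ℝ := fun w => if 0 < w 1 then C₁ (w 0) else C₂ (w 0)
  let O : Set (Fin 2 → ℝ) := {w | w 1 ≠ 0}
  have hO : IsOpen O := isOpen_ne_fun (by fun_prop) (by fun_prop)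
  have hpos : ∀ w : Fin 2 → ℝ, 0 < w 1 → Ψ =ᶠ[𝓝 w] fun w => C₁ (w 0) := fun w hw => by
    filter_upwards [(isOpen_lt continuous_const (continuous_apply 1)).mem_nhds hw] with z hz
    exact if_pos hz
  have hneg : ∀ w : Fin 2 → ℝ, w 1 < 0 → Ψ =ᶠ[𝓝 w] fun w => C₂ (w 0) := fun w hw => by
    filter_upwards [(isOpen_lt (continuous_apply 1) continuous_const).mem_nhds hw] with z hz
    exact if_neg (not_lt.2 (le_of_lt hz))
  have hΨ : ContDiffOn ℝ ∞ Ψ O := by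
    intro w hw
    refine ContDiffAt.contDiffWithinAt ?_
    rcases lt_or_gt_of_ne hw with hw | hw
    · exact ((hC₂.comp (contDiff_apply ℝ ℝ 0)).contDiffAt).congr_of_eventuallyEq (hneg w hw)
    · exact ((hC₁.comp (contDiff_apply ℝ ℝ 0)).contDiffAt).congr_of_eventuallyEq (hpos w hw)
  obtain ⟨γ, -, hγ⟩ := exists_smooth_comp ![coordT, coordU 1] hO hΨ fun a => a.2.1
  have hproj : ∀ w : Fin 2 → ℝ, HasFDerivAt (fun w : Fin 2 → ℝ => w 0)
      (ContinuousLinearMap.proj (R := ℝ) (φ := fun _ : Fin 2 => ℝ) 0) w := fun w =>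
    (ContinuousLinearMap.proj (R := ℝ) (φ := fun _ : Fin 2 => ℝ) 0).hasFDerivAt
  have key : ∀ (V : VF) (a : dom), (V.der γ).1 a = α.1 a * V.t.1 a := by
    intro V a
    have hb : ∀ σ (hσ : σ ≠ 0), 0 < a.1.u 1 * σ → ext α.1 (baseJet σ a.1.t) = α.1 a := by
      intro σ hσ h0
      rw [ext_apply _ (baseJet_mem hσ _)]
      exact (eq_of_D_eq_zero h a ⟨_, baseJet_mem hσ _⟩ rfl (by simpa [baseJet] using h0)).symm
    rw [hγ]
    set w : Fin 2 → ℝ := fun i => (![coordT, coordU 1] i).1 a with hw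
    have hv0 : (V.der (![coordT, coordU 1] 0)).1 a = V.t.1 a := by
      show (V.der coordT).1 a = _
      rw [V.der_coordT]
    rcases lt_or_gt_of_ne (show a.1.u 1 ≠ 0 from a.2.1) with h1 | h1
    · have hc : HasFDerivAt (fun w : Fin 2 → ℝ => C₂ (w 0)) _ w :=
        (hd₂ (w 0)).comp_hasFDerivAt w (hproj w)
      rw [(hneg w h1).fderiv_eq, hc.fderiv]
      simp only [smul_apply, ContinuousLinearMap.proj_apply, smul_eq_mul]
      rw [hv0]
      exact congrArg (· * _) (hb (-1) (by norm_num) (by linarith))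
    · have hc : HasFDerivAt (fun w : Fin 2 → ℝ => C₁ (w 0)) _ w :=
        (hd₁ (w 0)).comp_hasFDerivAt w (hproj w)
      rw [(hpos w h1).fderiv_eq, hc.fderiv]
      simp only [smul_apply, ContinuousLinearMap.proj_apply, smul_eq_mul]
      rw [hv0]
      exact congrArg (· * _) (hb 1 (by norm_num) (by linarith))
  exact ⟨γ, Subtype.ext (funext fun a => (key vfD a).trans (mul_zero _)),
    Subtype.ext (funext fun a => (key vfT a).trans (mul_one _))⟩

/-! ### Jets with constant Schwarzian -/

/-- The polynomials expressing the derivatives of `tan` through `tan`. -/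
def tanPoly : ℕ → Polynomial ℝ
  | 0 => Polynomial.X
  | k + 1 => (1 + Polynomial.X ^ 2) * Polynomial.derivative (tanPoly k)

/-- The jet of `σ tan` at `arctan τ`. -/
def tanJet (t σ τ : ℝ) : Jet := ⟨Real.arctan τ, t, fun k => σ * (tanPoly k).eval τ⟩

lemma tanJet_S (t : ℝ) {σ : ℝ} (hσ : σ ≠ 0) (τ : ℝ) :
    (tanJet t σ τ).u 1 = σ * (1 + τ ^ 2) ∧ S (tanJet t σ τ) = 2 := by
  have h1 : (tanJet t σ τ).u 1 = σ * (1 + τ ^ 2) := by simp [tanJet, tanPoly]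
  have h2 : (tanJet t σ τ).u 2 = σ * ((1 + τ ^ 2) * (2 * τ)) := by
    simp [tanJet, tanPoly, one_add_one_eq_two]
  have h3 : (tanJet t σ τ).u 3 = σ * ((1 + τ ^ 2) * (2 * τ * (2 * τ) + (1 + τ ^ 2) * 2)) := by
    simp [tanJet, tanPoly, one_add_one_eq_two]
  refine ⟨h1, ?_⟩
  have h0 : 1 + τ ^ 2 ≠ 0 := by positivity
  rw [S, h1, h2, h3]
  field_simp
  ring

lemma tanJet_mem (t : ℝ) {σ : ℝ} (hσ : σ ≠ 0) (τ : ℝ) : tanJet t σ τ ∈ dom := by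
  obtain ⟨h1, h2⟩ := tanJet_S t hσ τ
  refine ⟨?_, by rw [h2]; norm_num⟩
  rw [h1]
  positivity

lemma hasDerivAt_tanJet (t σ τ : ℝ) (n : ℕ) : HasDerivAt (fun z => trunc n (tanJet t σ z))
    ((1 + τ ^ 2)⁻¹ • trunc n ⟨1, 0, fun k => (tanJet t σ τ).u (k + 1)⟩) τ := by
  have h0 : 1 + τ ^ 2 ≠ 0 := by positivity
  refine HasDerivAt.prodMk ?_ (HasDerivAt.prodMk ?_ (hasDerivAt_pi.2 fun i => ?_))
  · show HasDerivAt Real.arctan ((1 + τ ^ 2)⁻¹ * 1) τ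
    rw [mul_one]
    exact Real.hasDerivAt_arctan' τ
  · show HasDerivAt (fun _ => t) ((1 + τ ^ 2)⁻¹ * 0) τ
    rw [mul_zero]
    exact hasDerivAt_const τ t
  · have h1 := ((tanPoly i).hasDerivAt τ).const_mul σ
    show HasDerivAt (fun y => σ * (tanPoly i).eval y) ((1 + τ ^ 2)⁻¹ *
      (σ * (tanPoly (i + 1)).eval τ)) τ
    refine h1.congr_deriv ?_
    simp only [tanPoly, Polynomial.eval_mul, Polynomial.eval_add, Polynomial.eval_one,
      Polynomial.eval_pow, Polynomial.eval_X]
    field_simp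

/-- The curve τ ↦ `tanJet t σ τ` is a reparametrized integral curve of D_x, so whatever is constant
along it has zero total derivative on it; S is constantly 2 there. -/
lemma Sx_tanJet (t : ℝ) {σ : ℝ} (hσ : σ ≠ 0) (k : ℕ) (hk : 1 ≤ k) (τ : ℝ) :
    Sx k (tanJet t σ τ) = 0 := by
  have key : ∀ k, (∃ c, ∀ τ, Sx k (tanJet t σ τ) = c) → ∀ τ, Sx (k + 1) (tanJet t σ τ) = 0 := by
    rintro k ⟨c, hc⟩ τ
    obtain ⟨n, hn⟩ := (agrees_Sx k).isDiffFun
    obtain ⟨f, hf⟩ := hn.exists_isRep (le_max_right n 3) (le_max_left n 3)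
    have h1 := hf.hasDerivAt (hasDerivAt_tanJet t σ τ _) (tanJet_mem t hσ τ)
    rw [map_smul, ← hf.along (tanJet_mem t hσ τ), ← Dx_eq_along, smul_eq_mul] at h1
    have h2 : HasDerivAt (fun z => Sx k (tanJet t σ z)) 0 τ := by
      simpa only [hc] using hasDerivAt_const τ c
    have h0 : (1 + τ ^ 2)⁻¹ ≠ 0 := by positivity
    have h3 := (mul_eq_zero.1 (h1.unique h2)).resolve_left h0
    simpa only [Sx, Function.iterate_succ_apply'] using h3
  induction k generalizing τ with
  | zero => omega
  | succ k ih =>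
    refine key k ?_ τ
    rcases k with _ | k
    · exact ⟨2, fun τ => (tanJet_S t hσ τ).2⟩
    · exact ⟨0, fun τ => ih (by omega) τ⟩

/-- The Schwarzian of the jet is constant to all orders. -/
def IsConst (a : dom) : Prop := ∀ k, 1 ≤ k → Sx k a = 0

/-- For each t and each sign of u_x there is a jet with constant Schwarzian, and α takes the same
value there. -/
theorem eq_zero_of_D_eq_zero {α : DiffFun} (h : D α = 0) (h0 : ∀ a, IsConst a → α.1 a = 0) :
    α = 0 := by
  refine Subtype.ext (funext fun a => ?_)
  have hσ : a.1.u 1 ≠ 0 := a.2.1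
  have h1 := eq_of_D_eq_zero h a ⟨_, tanJet_mem a.1.t hσ 0⟩ rfl (by
    show 0 < a.1.u 1 * (tanJet a.1.t (a.1.u 1) 0).u 1
    rw [(tanJet_S a.1.t hσ 0).1]
    have := mul_self_pos.2 hσ
    simpa using this)
  rw [h1]
  exact h0 _ fun k hk => Sx_tanJet a.1.t hσ k hk 0

/-! ### Functions of the Schwarzian and its derivatives -/

/-- Smooth functions of `S, S_x, ..., S_{nx}`. -/
def SchFun (n : ℕ) : Subalgebra ℝ DiffFun where
  carrier := {α | ∃ Ψ : (Fin (n + 1) → ℝ) → ℝ, ContDiffOn ℝ ∞ Ψ {s | 0 < s 0} ∧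
    ∀ a, α.1 a = Ψ fun i => Sx i a}
  mul_mem' := by
    rintro α β ⟨Ψ, hΨ, h⟩ ⟨Φ, hΦ, h'⟩
    exact ⟨Ψ * Φ, hΨ.mul hΦ, fun a => congrArg₂ (· * ·) (h a) (h' a)⟩
  add_mem' := by
    rintro α β ⟨Ψ, hΨ, h⟩ ⟨Φ, hΦ, h'⟩
    exact ⟨Ψ + Φ, hΨ.add hΦ, fun a => congrArg₂ (· + ·) (h a) (h' a)⟩
  algebraMap_mem' r := ⟨fun _ => r, contDiffOn_const, fun _ => rfl⟩

lemma SchFun_mono {m n : ℕ} (h : m ≤ n) : SchFun m ≤ SchFun n := by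
  rintro α ⟨Ψ, hΨ, hα⟩
  refine ⟨fun s => Ψ fun i => s (Fin.castLE (by omega) i), ?_, hα⟩
  exact hΨ.comp (contDiff_pi.2 fun i => contDiff_apply ℝ ℝ _).contDiffOn fun s hs => hs

lemma SchFun_D_formula {n : ℕ} {α : DiffFun} {Ψ : (Fin (n + 1) → ℝ) → ℝ}
    (hΨ : ContDiffOn ℝ ∞ Ψ {s | 0 < s 0}) (h : ∀ a, α.1 a = Ψ fun i => Sx i a) (a : dom) :
    (D α).1 a = fderiv ℝ Ψ (fun i => Sx i a) fun i => Sx (i + 1) a := by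
  have hS : ∀ k a, (D^[k] sch).1 a = Sx k a := fun k a => (agrees_Sx k a a.2).symm
  obtain ⟨β, hβ, hd⟩ := exists_smooth_comp (fun i : Fin (n + 1) => D^[i] sch)
    (isOpen_lt continuous_const (continuous_apply 0)) hΨ fun a => by
      show 0 < (D^[0] sch).1 a
      rw [hS]
      exact a.2.2
  have : α = β := Subtype.ext (funext fun a => by rw [h, hβ]; simp only [hS])
  rw [this]
  refine (hd vfD a).trans ?_
  simp only [hS]
  congr 1
  funext i
  rw [← hS, Function.iterate_succ_apply']
  rfl

lemma D_mem_SchFun {n : ℕ} {α : DiffFun} (h : α ∈ SchFun n) : D α ∈ SchFun (n + 1) := by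
  obtain ⟨Ψ, hΨ, hα⟩ := h
  have ho : IsOpen {s : Fin (n + 1) → ℝ | 0 < s 0} :=
    isOpen_lt continuous_const (continuous_apply 0)
  refine ⟨fun s => fderiv ℝ Ψ (fun i => s i.castSucc) fun i => s i.succ, ?_, fun a => ?_⟩
  · have h1 : ContDiff ℝ ∞ fun (s : Fin (n + 2) → ℝ) (i : Fin (n + 1)) => s i.castSucc := by
      fun_prop
    have h2 : ContDiff ℝ ∞ fun (s : Fin (n + 2) → ℝ) (i : Fin (n + 1)) => s i.succ := by
      fun_prop
    exact ((hΨ.fderiv_of_isOpen (m := ∞) ho (by simp)).comp h1.contDiffOn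
      fun s hs => hs).clm_apply h2.contDiffOn
  · rw [SchFun_D_formula hΨ hα]
    simp

lemma D_apply_of_isConst {n : ℕ} {α : DiffFun} (h : α ∈ SchFun n) {a : dom} (ha : IsConst a) :
    (D α).1 a = 0 := by
  obtain ⟨Ψ, hΨ, hα⟩ := h
  rw [SchFun_D_formula hΨ hα]
  have : (fun i : Fin (n + 1) => Sx (i + 1) a) = 0 := funext fun i => ha _ (by omega)
  rw [this, map_zero]

lemma sch_mem : sch ∈ SchFun 0 :=
  ⟨fun s => s 0, (contDiff_apply ℝ ℝ 0).contDiffOn, fun a => sch_apply a⟩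

lemma rs_mem : rs ∈ SchFun 0 := by
  refine ⟨fun s => (√(s 0))⁻¹, ?_, fun a => rs_apply a⟩
  intro s hs
  have hs' : 0 < s 0 := hs
  exact ((((contDiff_apply ℝ ℝ (0 : Fin 1)).contDiffAt (x := s)).sqrt hs'.ne').inv
    (Real.sqrt_pos.2 hs').ne').contDiffWithinAt

lemma dym_succ (n : ℕ) : dym (n + 1) = (1 / 4 : ℝ) • (rs * ((∑ i : Fin (n + 1),
    (2 * dym i * D (D (dym (n - i))) - D (dym i) * D (dym (n - i)))) -
      2 * sch * ∑ i : Fin n, dym (i + 1) * dym (n - i))) := dymCoeff.eq_2 _ _ _ _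

lemma dym_mem (n : ℕ) : dym n ∈ SchFun (2 * n) := by
  induction n using Nat.strong_induction_on with
  | _ n ih =>
    rcases n with _ | n
    · rw [dym_zero]; exact rs_mem
    · have hm : ∀ {k l : ℕ} {α : DiffFun}, α ∈ SchFun k → k ≤ l → α ∈ SchFun l :=
        fun h hk => SchFun_mono hk h
      have h2 : (2 : DiffFun) ∈ SchFun (2 * (n + 1)) := ofNat_mem _ 2
      rw [dym_succ]
      refine Subalgebra.smul_mem _ (mul_mem (hm rs_mem (by omega)) (sub_mem (sum_mem fun i _ => ?_)
        (mul_mem (mul_mem h2 (hm sch_mem (by omega))) (sum_mem fun i _ => ?_)))) _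
      · have hi := i.2
        have h3 := ih i (by omega)
        have h4 := ih (n - i) (by omega)
        exact sub_mem (mul_mem (mul_mem h2 (hm h3 (by omega)))
            (hm (D_mem_SchFun (D_mem_SchFun h4)) (by omega)))
          (mul_mem (hm (D_mem_SchFun h3) (by omega)) (hm (D_mem_SchFun h4) (by omega)))
      · have hi := i.2
        exact mul_mem (hm (ih (i + 1) (by omega)) (by omega)) (hm (ih (n - i) (by omega)) (by omega))

/-- Each term of the recursion for b_{n+1} contains a total derivative of some b_i or an earlier b_i
with i ≥ 1. -/
lemma dym_succ_apply_of_isConst (n : ℕ) {a : dom} (ha : IsConst a) : (dym (n + 1)).1 a = 0 := by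
  induction n using Nat.strong_induction_on with
  | _ n ih =>
    have hev : ∀ α : DiffFun, α.1 a = (Pi.evalAlgHom ℝ (fun _ : dom => ℝ) a).comp DiffFun.val α :=
      fun _ => rfl
    have h1 : ∀ i : Fin n, (dym (i + 1)).1 a = 0 := fun i => ih i i.2
    have h2 : ∀ m, (D (dym m)).1 a = 0 := fun m => D_apply_of_isConst (dym_mem m) ha
    have h3 : ∀ m, (D (D (dym m))).1 a = 0 := fun m =>
      D_apply_of_isConst (D_mem_SchFun (dym_mem m)) ha
    rw [dym_succ]
    simp only [hev] at *
    simp only [map_smul, map_mul, map_sub, map_sum, h1, h2, h3, mul_zero, zero_mul,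
      Finset.sum_const_zero, sub_zero, smul_zero]

lemma HasOrderLE.dx {n : ℕ} (hn : 3 ≤ n) {F : Jet → ℝ} (hF : HasOrderLE n F) :
    HasOrderLE (n + 1) (Dx F) := by
  obtain ⟨f, hf⟩ := hF.exists_isRep hn le_rfl
  refine (isRep_der (V := vfD) (Nat.le_succ n) hf
    (v := fun p => (1, 0, fun i => p.2.2 i.succ)) (by fun_prop) (fun a => rfl) fun a => ?_).hasOrderLE
  rw [Dx_eq_along]
  rfl

lemma hasOrderLE_Sx (k : ℕ) : HasOrderLE (k + 3) (Sx k) := by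
  induction k with
  | zero =>
    refine ⟨fun p => p.2.2 3 / p.2.2 1 - 3 / 2 * (p.2.2 2 ^ 2 / p.2.2 1 ^ 2), ?_, fun a _ => rfl⟩
    rintro _ ⟨a, ha, rfl⟩
    have h1 : (trunc 3 a).2.2 1 ≠ 0 := ha.1
    refine ContDiffAt.contDiffWithinAt ?_
    refine ContDiffAt.sub (ContDiffAt.div (by fun_prop) (by fun_prop) h1)
      (contDiffAt_const.mul (ContDiffAt.div (by fun_prop) (by fun_prop) (pow_ne_zero 2 h1)))
  | succ k ih =>
    have := ih.dx (by omega)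
    simpa only [Sx, Function.iterate_succ_apply'] using this

lemma hasOrderLE_of_mem {n : ℕ} {α : DiffFun} (h : α ∈ SchFun n) :
    HasOrderLE (n + 3) (ext α.1) ∧ HasOrderLE (n + 3) (ext (coordU 1 * α).1) := by
  obtain ⟨Ψ, hΨ, hα⟩ := h
  choose f hf using fun i : Fin (n + 1) =>
    (hasOrderLE_Sx i).exists_isRep (m := n + 3) (by omega) (by omega)
  have h1 : ContDiffOn ℝ ∞ (fun p => Ψ fun i => f i p) (trunc (n + 3) '' dom) := by
    refine hΨ.comp (contDiffOn_pi.2 fun i => (hf i).smooth) ?_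
    rintro _ ⟨a, ha, rfl⟩
    show 0 < f 0 (trunc (n + 3) a)
    rw [← (hf 0).eq a ha]
    exact ha.2
  have h2 : ∀ a : dom, α.1 a = Ψ fun i => f i (trunc (n + 3) a) := fun a => by
    rw [hα]
    congr 1
    exact funext fun i => (hf i).eq a a.2
  constructor
  · exact ⟨_, h1, fun a ha => by rw [ext_apply _ ha, h2]⟩
  · refine ⟨fun p => p.2.2 ⟨1, by omega⟩ * Ψ fun i => f i p, ContDiffOn.mul (by fun_prop) h1,
      fun a ha => ?_⟩
    rw [ext_apply _ ha]
    exact congrArg (a.u 1 * ·) (h2 ⟨a, ha⟩)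

end

/-! ### The recursion operator in the algebra of differential functions -/

lemma D_rs : D rs = -(1 / 2 : ℝ) • (rs ^ 3 * D sch) := by
  have h := congrArg D rs_mul_rs_mul_sch
  simp only [Derivation.leibniz, smul_eq_mul, Derivation.map_one_eq_zero] at h
  rw [Algebra.smul_def, map_neg]
  linear_combination (algebraMap ℝ DiffFun (1 / 2)) * rs * h -
    D rs * two_half - 2 * algebraMap ℝ DiffFun (1 / 2) * D rs * rs_mul_rs_mul_sch

lemma val_mul (α β : DiffFun) (a : dom) : (α * β).1 a = α.1 a * β.1 a := rfl
lemma val_add (α β : DiffFun) (a : dom) : (α + β).1 a = α.1 a + β.1 a := rfl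
lemma val_sub (α β : DiffFun) (a : dom) : (α - β).1 a = α.1 a - β.1 a := rfl
lemma val_smul (r : ℝ) (α : DiffFun) (a : dom) : (r • α).1 a = r * α.1 a := rfl
lemma val_pow (α : DiffFun) (n : ℕ) (a : dom) : (α ^ n).1 a = α.1 a ^ n := rfl
lemma val_nsmul (n : ℕ) (α : DiffFun) (a : dom) : (n • α).1 a = n * α.1 a := by
  show (n • α.1) a = _
  simp
lemma val_coordU (k : ℕ) (a : dom) : (coordU k).1 a = a.1.u k := rfl

lemma D_D_rs : D (D rs) =
    (3 / 4 : ℝ) • (rs ^ 5 * D sch ^ 2) - (1 / 2 : ℝ) • (rs ^ 3 * D (D sch)) := by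
  rw [D_rs, Derivation.map_smul, Derivation.leibniz, Derivation.leibniz_pow, D_rs]
  refine Subtype.ext (funext fun a => ?_)
  simp only [val_mul, val_add, val_sub, val_smul, val_pow, val_nsmul, smul_eq_mul,
    Nat.cast_ofNat]
  ring

lemma D_D_D_rs : D (D (D rs)) = (9 / 4 : ℝ) • (rs ^ 5 * D sch * D (D sch)) -
    (15 / 8 : ℝ) • (rs ^ 7 * D sch ^ 3) - (1 / 2 : ℝ) • (rs ^ 3 * D (D (D sch))) := by
  rw [D_D_rs]
  simp only [map_sub, Derivation.map_smul, Derivation.leibniz, Derivation.leibniz_pow, D_rs]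
  refine Subtype.ext (funext fun a => ?_)
  simp only [val_mul, val_add, val_sub, val_smul, val_pow, val_nsmul, smul_eq_mul,
    Nat.cast_ofNat]
  ring

section

variable (lam k1 k2 : ℝ)

lemma agrees_K : Agrees (K lam) (coordU 1 * (lam • rs)) := by
  intro a ha
  rw [val_mul, val_smul, val_coordU, rs_apply, K, div_eq_mul_inv]
  ring

lemma Sx_eq (k : ℕ) {a : Jet} (ha : a ∈ dom) : Sx k a = (D^[k] sch).1 ⟨a, ha⟩ := agrees_Sx k a ha

lemma agrees_Lam (hlam : lam ≠ 0) :
    Agrees (Lam lam k2) ((k2 / (2 * lam)) • (invUx * D (D (D rs)))) := by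
  intro a ha
  rw [Lam, Sx_eq 1 ha, Sx_eq 2 ha, Sx_eq 3 ha, D_D_D_rs]
  simp only [val_mul, val_sub, val_smul, val_pow, rs_apply, invUx_apply, Function.iterate_succ,
    Function.iterate_zero, Function.comp, id]
  have h1 := ha.1
  have h2 : √(S a) ≠ 0 := (Real.sqrt_pos.2 ha.2).ne'
  field_simp
  ring

/-- The part of the recursion operator without its constant term, as an operator on
`f = Q / u_x`, with `p` the chosen value of the antiderivative. -/
def recur (f p : DiffFun) : DiffFun :=
  rs * (lam • p - (k2 / 2) • (rs * D (D f) - D rs * D f + D (D rs) * f))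

/-- The value of the antiderivative for which `recur` has a given value. -/
def potentialOf (f g : DiffFun) : DiffFun :=
  lam⁻¹ • (sch * rs * g + (k2 / 2) • (rs * D (D f) - D rs * D f + D (D rs) * f))

lemma recur_potentialOf (hlam : lam ≠ 0) (f g : DiffFun) :
    recur lam k2 f (potentialOf lam k2 f g) = g := by
  rw [recur, potentialOf, smul_smul, mul_inv_cancel₀ hlam, one_smul]
  linear_combination g * rs_mul_rs_mul_sch

lemma agrees_R {Q P : Jet → ℝ} {f p : DiffFun} (hQ : Agrees Q (coordU 1 * f)) (hP : Agrees P p) :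
    Agrees (R lam k1 k2 Q P) (coordU 1 * ((k1 + k2 / 2) • f + recur lam k2 f p)) := by
  intro a ha
  have h1 := hQ.dx a ha
  have h2 := hQ.dx.dx a ha
  rw [D_coordU_one_mul] at h1 h2
  rw [D_coordU_one_mul] at h2
  -- Eliminating the derivative of `preSch` in favour of S, and S in favour of r^{-2}, leaves a
  -- rational identity in `preSch`, r, f, p and derivatives of S and f.
  have hpre : D preSch = sch + (1 / 2 : ℝ) • preSch ^ 2 := by rw [sch_eq]; ring
  simp only [map_add, Derivation.leibniz, hpre] at h2
  have hv : a.u 2 / a.u 1 = preSch.1 ⟨a, ha⟩ := by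
    rw [preSch, val_mul, invUx_apply, val_coordU, div_eq_mul_inv]
  have hS : sch.1 ⟨a, ha⟩ = (rs.1 ⟨a, ha⟩ ^ 2)⁻¹ := by
    rw [rs_apply, sch_apply, inv_pow, inv_inv, Real.sq_sqrt ha.2.le]
  have hS' : S a = (rs.1 ⟨a, ha⟩ ^ 2)⁻¹ := by rw [← hS, sch_apply]
  have hr : rs.1 ⟨a, ha⟩ ≠ 0 := by
    rw [rs_apply]; exact inv_ne_zero (Real.sqrt_pos.2 ha.2).ne'
  have hK := agrees_K lam a ha
  rw [R, G0, G1, G2, ← div_pow, hv, Sx_eq 1 ha, Sx_eq 2 ha, hK, h1, h2, hQ a ha, hP a ha, hS', recur,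
    D_D_rs, D_rs]
  simp only [val_mul, val_add, val_sub, val_smul, val_pow, val_coordU, hS, smul_eq_mul,
    Function.iterate_succ, Function.iterate_zero, Function.comp, id]
  field_simp
  ring

/-- Write g = r w. As J r = 0, J g = 2 S r w', and in w' = λ p' - (k2/2)(r f''' + r''' f) the
equation for p cancels exactly the term with r'''. Then S r² = 1 leaves -k2 f'''. -/
lemma isPotential_iff (hlam : lam ≠ 0) {Q P : Jet → ℝ} {f p : DiffFun}
    (hQ : Agrees Q (coordU 1 * f)) (hP : Agrees P p) :
    IsPotential lam k2 Q P ↔ J2 D sch (recur lam k2 f p) = -k2 • D (D (D f)) := by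
  have hrhs : Agrees (fun a => Lam lam k2 a * Q a) ((k2 / (2 * lam)) • (D (D (D rs)) * f)) := by
    intro a ha
    show Lam lam k2 a * Q a = _
    rw [agrees_Lam lam k2 hlam a ha, hQ a ha]
    have h1 := congrArg (fun α : DiffFun => α.1 ⟨a, ha⟩) coordU_mul_invUx
    have h2 : a.u 1 * invUx.1 ⟨a, ha⟩ = 1 := h1
    simp only [val_smul, val_mul, val_coordU]
    linear_combination (k2 / (2 * lam)) * (D (D (D rs))).1 ⟨a, ha⟩ * f.1 ⟨a, ha⟩ * h2
  have h1 : IsPotential lam k2 Q P ↔ D p = (k2 / (2 * lam)) • (D (D (D rs)) * f) :=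
    ⟨fun h => (hP.dx.congr_iff hrhs).1 h.2, fun h => ⟨hP.isDiffFun, (hP.dx.congr_iff hrhs).2 h⟩⟩
  have h2 : J2 D sch (recur lam k2 f p) = 2 * sch * rs *
      (lam • D p - (k2 / 2) • (rs * D (D (D f)) + D (D (D rs)) * f)) := by
    have h3 := J2_dym_zero
    rw [dym_zero, J2] at h3
    rw [recur, J2]
    simp only [map_add, map_sub, Derivation.map_smul, Derivation.leibniz, smul_eq_mul]
    -- The derivative of r f'' - r' f' + r'' f telescopes to r f''' + r''' f.
    rw [show rs * D (D (D f)) + D (D (D rs)) * f = rs * D (D (D f)) + D (D f) * D rs -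
      (D rs * D (D f) + D f * D (D rs)) + (D (D rs) * D f + f * D (D (D rs))) by ring]
    linear_combination (lam • p - (k2 / 2) • (rs * D (D f) - D rs * D f + D (D rs) * f)) * h3
  have h4 : J2 D sch (recur lam k2 f p) + k2 • D (D (D f)) = 2 * sch * rs *
      (lam • (D p - (k2 / (2 * lam)) • (D (D (D rs)) * f))) := by
    have h5 : lam * (k2 / (2 * lam)) = k2 / 2 := by field_simp
    have h6 : k2 • D (D (D f)) = (2 * sch * rs) * ((k2 / 2) • (rs * D (D (D f)))) := by
      have h7 : k2 = 2 * (k2 / 2) := by ring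
      have h8 : k2 • D (D (D f)) = 2 * ((k2 / 2) • D (D (D f))) := by
        conv_lhs => rw [h7, mul_smul, Algebra.smul_def, map_ofNat]
      rw [h8]
      simp only [Algebra.smul_def]
      linear_combination (-2 * algebraMap ℝ DiffFun (k2 / 2) * D (D (D f))) * rs_mul_rs_mul_sch
    rw [h2, h6, smul_sub, smul_smul, h5, smul_add]
    ring
  have hu : IsUnit (2 * sch * rs) := (isUnit_two.mul isUnit_sch).mul isUnit_rs
  rw [h1, neg_smul, ← sub_eq_zero, ← add_eq_zero_iff_eq_neg, h4, hu.mul_right_eq_zero,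
    smul_eq_zero_iff_right hlam]

/-! ### Recursion operators -/

lemma ad_add_left (b c f : DiffFun) : ad (b + c) f = ad b f + ad c f := by
  rw [ad, ad, ad, mul_add, pr_add, map_add, br, br, br, map_add]; ring

lemma ad_smul_left (r : ℝ) (b f : DiffFun) : ad (r • b) f = r • ad b f := by
  simp only [ad, br, mul_smul_comm, pr_smul, Derivation.map_smul, smul_mul_assoc, smul_sub]

lemma ad_zero_left (f : DiffFun) : ad 0 f = 0 := by simpa using ad_smul_left 0 0 f

lemma ad_add_right (b f g : DiffFun) : ad b (f + g) = ad b f + ad b g := by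
  rw [ad, ad, ad, mul_add, pr_add, map_add, br, br, br, map_add]; ring

lemma ad_smul_right (r : ℝ) (b f : DiffFun) : ad b (r • f) = r • ad b f := by
  simp only [ad, br, mul_smul_comm, pr_smul, Derivation.map_smul, smul_sub]

lemma ad_zero_right (b : DiffFun) : ad b 0 = 0 := by simpa using ad_smul_right 0 b 0

lemma ad_const_mul_right {γ : DiffFun} (hγ : D γ = 0) (b f : DiffFun) :
    ad b (γ * f) = γ * ad b f := by
  rw [ad, ad, mul_left_comm, pr_const_mul hγ, br, br, Derivation.leibniz, Derivation.leibniz, hγ,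
    pr_of_D_eq_zero hγ]
  simp only [smul_eq_mul]
  ring

/-- The span of the basic hierarchy. -/
def dymSpan : Submodule ℝ DiffFun := Submodule.span ℝ (Set.range dym)

lemma J2_ad {b f g : DiffFun} (hb : b ∈ dymSpan) (h : J2 D sch g = D (D (D f))) :
    J2 D sch (ad b g) = D (D (D (ad b f))) := by
  induction hb using Submodule.span_induction with
  | mem b hb => obtain ⟨n, rfl⟩ := hb; exact J2_ad_dym h n
  | zero => simp [ad_zero_left, J2]
  | add b c _ _ hb hc => simp only [ad_add_left, J2_add, hb, hc, map_add]
  | smul r b _ hb => simp only [ad_smul_left, J2_smul, hb, Derivation.map_smul]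

lemma ad_eq_zero {b c : DiffFun} (hb : b ∈ dymSpan) (hc : c ∈ dymSpan) : ad b c = 0 := by
  induction hb using Submodule.span_induction with
  | mem b hb =>
    obtain ⟨n, rfl⟩ := hb
    induction hc using Submodule.span_induction with
    | mem c hc => obtain ⟨m, rfl⟩ := hc; exact ad_dym_dym n m
    | zero => exact ad_zero_right _
    | add c c' _ _ h h' => rw [ad_add_right, h, h', add_zero]
    | smul r c _ h => rw [ad_smul_right, h, smul_zero]
  | zero => exact ad_zero_left _
  | add b b' _ _ h h' => rw [ad_add_left, h, h', add_zero]
  | smul r b _ h => rw [ad_smul_left, h, smul_zero]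

lemma dt_eq_zero {b : DiffFun} (hb : b ∈ dymSpan) : dt b = 0 := by
  induction hb using Submodule.span_induction with
  | mem b hb => obtain ⟨n, rfl⟩ := hb; exact dt_dym n
  | zero => exact map_zero _
  | add b b' _ _ h h' => rw [map_add, h, h', add_zero]
  | smul r b _ h => rw [Derivation.map_smul, h, smul_zero]

lemma rs_mem_dymSpan : rs ∈ dymSpan := Submodule.subset_span ⟨0, dym_zero⟩

lemma isSymmetry_of_mem {E Q : Jet → ℝ} {b c : DiffFun} (hb : b ∈ dymSpan) (hc : c ∈ dymSpan)
    (hE : Agrees E (coordU 1 * b)) (hQ : Agrees Q (coordU 1 * c)) : IsSymmetry E Q := by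
  refine ⟨hQ.isDiffFun, fun a ha => ?_⟩
  rw [hE.linOp hQ a ha, linearized_mul, dt_eq_zero hc, ad_eq_zero hb hc]
  simp

/-- The relation defining the recursion operator is preserved by the linearized flows. -/
lemma J2_dt_add_ad (hk2 : k2 ≠ 0) {b f g : DiffFun} (hb : b ∈ dymSpan)
    (h : J2 D sch g = -k2 • D (D (D f))) :
    J2 D sch (dt g + ad b g) = -k2 • D (D (D (dt f + ad b f))) := by
  have hk : -k2 ≠ 0 := neg_ne_zero.2 hk2
  have h1 : J2 D sch ((-k2)⁻¹ • g) = D (D (D f)) := by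
    rw [J2_smul, h, smul_smul, inv_mul_cancel₀ hk, one_smul]
  have h2 := J2_ad hb h1
  rw [ad_smul_right, J2_smul, inv_smul_eq_iff₀ hk] at h2
  have h3 := congrArg dt h
  rw [derivation_J2 dt_D, dt_sch, Derivation.map_smul, dt_D, dt_D, dt_D] at h3
  simp only [mul_zero, zero_mul, map_zero, add_zero] at h3
  rw [J2_add, h2, h3, map_add, map_add, map_add, smul_add]

lemma exists_mul_agrees {Q : Jet → ℝ} (h : IsDiffFun Q) : ∃ f, Agrees Q (coordU 1 * f) := by
  obtain ⟨q, hq⟩ := h.exists_agrees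
  refine ⟨invUx * q, ?_⟩
  rwa [← mul_assoc, coordU_mul_invUx, one_mul]

theorem isRecursionOperator_of_mem (hlam : lam ≠ 0) (hk2 : k2 ≠ 0) {E : Jet → ℝ} {b : DiffFun}
    (hb : b ∈ dymSpan) (hE : Agrees E (coordU 1 * b)) : IsRecursionOperator lam k1 k2 E := by
  have comm : ∀ {Q P : Jet → ℝ} {f p : DiffFun}, Agrees Q (coordU 1 * f) → Agrees P p →
      IsPotential lam k2 Q P → ∃ (P' : Jet → ℝ) (p' : DiffFun), Agrees P' p' ∧
        IsPotential lam k2 (linOp E Q) P' ∧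
        linearized (coordU 1 * b) (coordU 1 * ((k1 + k2 / 2) • f + recur lam k2 f p)) =
        coordU 1 * ((k1 + k2 / 2) • (dt f + ad b f) + recur lam k2 (dt f + ad b f) p') := by
    intro Q P f p hQ hP hpot
    have hrel := (isPotential_iff lam k2 hlam hQ hP).1 hpot
    have hL := hE.linOp hQ
    rw [linearized_mul] at hL
    let g := recur lam k2 f p
    -- The antiderivative for L Q is chosen so that `recur` returns the linearized flow of g;
    -- `J2_dt_add_ad` makes this choice admissible.
    let p' := potentialOf lam k2 (dt f + ad b f) (dt g + ad b g)
    refine ⟨ext p'.1, p', agrees_ext p', ?_, ?_⟩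
    · rw [isPotential_iff lam k2 hlam hL (agrees_ext p'), recur_potentialOf lam k2 hlam]
      exact J2_dt_add_ad k2 hk2 hb hrel
    · rw [recur_potentialOf lam k2 hlam, linearized_mul, map_add, Derivation.map_smul,
        ad_add_right, ad_smul_right, smul_add]
      ring
  constructor
  · intro Q P hQ hpot
    obtain ⟨f, hf⟩ := exists_mul_agrees hQ
    obtain ⟨p, hp⟩ := hpot.1.exists_agrees
    obtain ⟨P', p', hP', hpot', he⟩ := comm hf hp hpot
    have hL := hE.linOp hf
    rw [linearized_mul] at hL
    refine ⟨P', hpot', ?_⟩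
    exact ((hE.linOp (agrees_R lam k1 k2 hf hp)).congr_iff (agrees_R lam k1 k2 hL hP')).2 he
  · intro Q P hQ hpot
    obtain ⟨f, hf⟩ := exists_mul_agrees hQ.1
    obtain ⟨p, hp⟩ := hpot.1.exists_agrees
    obtain ⟨P', p', hP', hpot', he⟩ := comm hf hp hpot
    have hL := hE.linOp hf
    have hf0 : dt f + ad b f = 0 := by
      have h1 : linearized (coordU 1 * b) (coordU 1 * f) = 0 :=
        (hL.congr_iff (G := fun _ => 0) (β := 0) fun _ _ => rfl).1 hQ.2
      rw [linearized_mul] at h1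
      linear_combination invUx * h1 - (dt f + ad b f) * coordU_mul_invUx
    have hp0 : D p' = 0 := by
      have hD := hpot'.2
      refine (hP'.dx.congr_iff (G := fun _ => 0) (β := 0) fun _ _ => rfl).1 fun a ha => ?_
      rw [hD a ha, hQ.2 a ha, mul_zero]
    -- As L Q = 0, L(R Q) = λ p' r u_x with p' in the kernel of D. Replacing p by p - γ changes R Q
    -- by -λ γ r u_x, to which L assigns -λ γ_t r u_x because u_x r is itself a symmetry without
    -- explicit t.
    obtain ⟨γ, hγ, hγt⟩ := exists_dt_primitive hp0
    have hag := agrees_ext (p - γ)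
    have hpot2 : IsPotential lam k2 Q (ext (p - γ).1) := by
      refine ⟨hag.isDiffFun, fun a ha => ?_⟩
      rw [← hpot.2 a ha, hag.dx a ha, hp.dx a ha, map_sub, hγ, sub_zero]
    refine ⟨_, hpot2, (agrees_R lam k1 k2 hf hag).isDiffFun, fun a ha => ?_⟩
    rw [hE.linOp (agrees_R lam k1 k2 hf hag) a ha]
    have hsub : recur lam k2 f (p - γ) = recur lam k2 f p + (-lam) • (γ * rs) := by
      simp only [recur, Algebra.smul_def, map_neg]
      ring
    have hrec0 : recur lam k2 0 p' = lam • (p' * rs) := by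
      simp only [recur, map_zero, mul_zero, sub_zero, add_zero, Algebra.smul_def]
      ring
    have hmain : linearized (coordU 1 * b)
        (coordU 1 * ((k1 + k2 / 2) • f + recur lam k2 f (p - γ))) = 0 := by
      rw [hf0, hrec0, smul_zero, zero_add, linearized_mul] at he
      rw [hsub, ← add_assoc, linearized_mul, map_add, ad_add_right, Derivation.map_smul,
        ad_smul_right, ad_const_mul_right hγ, ad_eq_zero hb rs_mem_dymSpan, Derivation.leibniz,
        hγt, dt_eq_zero rs_mem_dymSpan]
      simp only [mul_zero, smul_zero, add_zero, zero_add, smul_eq_mul, neg_smul]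
      rw [mul_comm rs p']
      linear_combination he
    rw [hmain]
    rfl

end

/-! ### The shift on the basic hierarchy as multiplication by X -/

open Polynomial in
/-- The linear map sending `X ^ n` to the `n`-th member of the basic hierarchy. -/
def dymPoly : ℝ[X] →ₗ[ℝ] DiffFun := (basisMonomials ℝ).constr ℝ dym

lemma dymPoly_monomial (n : ℕ) (r : ℝ) : dymPoly (Polynomial.monomial n r) = r • dym n := by
  have h := (Polynomial.basisMonomials ℝ).constr_basis ℝ dym n
  rw [Polynomial.coe_basisMonomials] at h
  have h1 : Polynomial.monomial n r = r • Polynomial.monomial n (1 : ℝ) := by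
    rw [Polynomial.smul_monomial, smul_eq_mul, mul_one]
  rw [h1, map_smul]
  exact congrArg (r • ·) h

lemma dymPoly_C_mul (r : ℝ) (p : Polynomial ℝ) : dymPoly (Polynomial.C r * p) = r • dymPoly p := by
  rw [← Polynomial.smul_eq_C_mul, map_smul]

lemma dymPoly_mem (p : Polynomial ℝ) : dymPoly p ∈ dymSpan := by
  induction p using Polynomial.induction_on' with
  | add p q hp hq => rw [map_add]; exact add_mem hp hq
  | monomial n r =>
    rw [dymPoly_monomial]
    exact Submodule.smul_mem _ _ (Submodule.subset_span ⟨n, rfl⟩)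

lemma J2_dymPoly_X_mul (p : Polynomial ℝ) :
    J2 D sch (dymPoly (Polynomial.X * p)) = D (D (D (dymPoly p))) := by
  induction p using Polynomial.induction_on' with
  | add p q hp hq => simp only [mul_add, map_add, J2_add, hp, hq]
  | monomial n r =>
    rw [Polynomial.X_mul_monomial, dymPoly_monomial, dymPoly_monomial, J2_smul, J2_dym_succ]
    simp only [Derivation.map_smul]

lemma dymPoly_X_mul_apply_of_isConst (p : Polynomial ℝ) {a : dom} (ha : IsConst a) :
    (dymPoly (Polynomial.X * p)).1 a = 0 := by
  induction p using Polynomial.induction_on' with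
  | add p q hp hq => rw [mul_add, map_add, val_add, hp, hq, add_zero]
  | monomial n r =>
    rw [Polynomial.X_mul_monomial, dymPoly_monomial, val_smul, dym_succ_apply_of_isConst n ha,
      mul_zero]

lemma dymPoly_mem_SchFun {p : Polynomial ℝ} {n : ℕ} (hp : p.natDegree ≤ n) :
    dymPoly p ∈ SchFun (2 * n) := by
  rw [p.as_sum_range' (n + 1) (by omega), map_sum]
  refine sum_mem fun i hi => ?_
  rw [dymPoly_monomial]
  have := Finset.mem_range.1 hi
  exact Subalgebra.smul_mem _ (SchFun_mono (by omega) (dym_mem i)) _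

/-! ### The hierarchy -/

section

variable (lam k1 k2 : ℝ)

/-- The polynomial expressing a member of the hierarchy through the basic hierarchy. -/
def hierPoly (j : ℕ) : Polynomial ℝ :=
  Polynomial.C lam * (Polynomial.C (k1 + k2 / 2) - Polynomial.C k2 * Polynomial.X) ^ j

/-- The `j`-th member of the hierarchy, divided by `u_x`. -/
def hier (j : ℕ) : DiffFun := dymPoly (hierPoly lam k1 k2 j)

/-- The image of a member of the hierarchy under the nonconstant part of the recursion operator. -/
def hierTail (j : ℕ) : DiffFun :=
  dymPoly (Polynomial.X * (Polynomial.C (-k2) * hierPoly lam k1 k2 j))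

lemma natDegree_hierPoly (j : ℕ) : (hierPoly lam k1 k2 j).natDegree ≤ j := by
  have h1 : (Polynomial.C (k1 + k2 / 2) - Polynomial.C k2 * Polynomial.X).natDegree ≤ 1 := by
    compute_degree
  calc (hierPoly lam k1 k2 j).natDegree
      ≤ ((Polynomial.C (k1 + k2 / 2) - Polynomial.C k2 * Polynomial.X) ^ j).natDegree :=
        Polynomial.natDegree_C_mul_le _ _
    _ ≤ j * 1 := Polynomial.natDegree_pow_le_of_le j h1
    _ = j := mul_one j

lemma hier_succ (j : ℕ) :
    hier lam k1 k2 (j + 1) = (k1 + k2 / 2) • hier lam k1 k2 j + hierTail lam k1 k2 j := by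
  rw [hier, hier, hierTail, ← dymPoly_C_mul, ← map_add]
  congr 1
  rw [hierPoly, hierPoly, pow_succ, Polynomial.C_neg]
  ring

lemma hier_zero : hier lam k1 k2 0 = lam • rs := by
  rw [hier, hierPoly, pow_zero, dymPoly_C_mul, ← Polynomial.monomial_zero_one, dymPoly_monomial,
    dym_zero, one_smul]

lemma hier_mem (j : ℕ) : hier lam k1 k2 j ∈ dymSpan := dymPoly_mem _

lemma hier_mem_SchFun (j : ℕ) : hier lam k1 k2 j ∈ SchFun (2 * j) :=
  dymPoly_mem_SchFun (natDegree_hierPoly lam k1 k2 j)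

lemma hierTail_mem_SchFun (j : ℕ) : hierTail lam k1 k2 j ∈ SchFun (2 * (j + 1)) := by
  refine dymPoly_mem_SchFun ?_
  have h1 := (Polynomial.natDegree_C_mul_le (-k2) (hierPoly lam k1 k2 j)).trans
    (natDegree_hierPoly lam k1 k2 j)
  have h2 := Polynomial.natDegree_mul_le (p := Polynomial.X)
    (q := Polynomial.C (-k2) * hierPoly lam k1 k2 j)
  have h3 := Polynomial.natDegree_X_le (R := ℝ)
  omega

lemma J2_hierTail (j : ℕ) :
    J2 D sch (hierTail lam k1 k2 j) = -k2 • D (D (D (hier lam k1 k2 j))) := by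
  rw [hierTail, J2_dymPoly_X_mul, dymPoly_C_mul]
  simp only [Derivation.map_smul]
  rfl

/-- The `j`-th member of the hierarchy as a function on jets. -/
def member (j : ℕ) : Jet → ℝ := ext (coordU 1 * hier lam k1 k2 j).1

lemma agrees_member (j : ℕ) : Agrees (member lam k1 k2 j) (coordU 1 * hier lam k1 k2 j) :=
  agrees_ext _

/-- The antiderivative with zero integration constant. -/
def hierPotential (j : ℕ) : DiffFun :=
  potentialOf lam k2 (hier lam k1 k2 j) (hierTail lam k1 k2 j)

lemma hierPotential_apply_of_isConst (j : ℕ) {a : dom} (ha : IsConst a) :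
    (hierPotential lam k1 k2 j).1 a = 0 := by
  have h1 : (D (D rs)).1 a = 0 := D_apply_of_isConst (D_mem_SchFun rs_mem) ha
  have h2 : (D (hier lam k1 k2 j)).1 a = 0 := D_apply_of_isConst (hier_mem_SchFun lam k1 k2 j) ha
  have h3 : (D (D (hier lam k1 k2 j))).1 a = 0 :=
    D_apply_of_isConst (D_mem_SchFun (hier_mem_SchFun lam k1 k2 j)) ha
  have h4 : (hierTail lam k1 k2 j).1 a = 0 := dymPoly_X_mul_apply_of_isConst _ ha
  rw [hierPotential, potentialOf]
  simp only [val_smul, val_add, val_sub, val_mul, h1, h2, h3, h4]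
  ring

lemma isPotential_hierPotential (hlam : lam ≠ 0) {Q P : Jet → ℝ} {j : ℕ}
    (hQ : Agrees Q (coordU 1 * hier lam k1 k2 j)) (hP : Agrees P (hierPotential lam k1 k2 j)) :
    IsPotential lam k2 Q P := by
  rw [isPotential_iff lam k2 hlam hQ hP, hierPotential, recur_potentialOf lam k2 hlam]
  exact J2_hierTail lam k1 k2 j

lemma agrees_R_hier (hlam : lam ≠ 0) {Q P : Jet → ℝ} {j : ℕ}
    (hQ : Agrees Q (coordU 1 * hier lam k1 k2 j)) (hP : Agrees P (hierPotential lam k1 k2 j)) :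
    Agrees (R lam k1 k2 Q P) (coordU 1 * hier lam k1 k2 (j + 1)) := by
  have := agrees_R lam k1 k2 hQ hP
  rwa [hierPotential, recur_potentialOf lam k2 hlam, ← hier_succ] at this

lemma agrees_K_hier : Agrees (K lam) (coordU 1 * hier lam k1 k2 0) := by
  rw [hier_zero]
  exact agrees_K lam

theorem isHierarchy_member (hlam : lam ≠ 0) : IsHierarchy lam k1 k2 (member lam k1 k2) := by
  have hm := agrees_member lam k1 k2
  refine ⟨((hm 0).congr_iff (agrees_K_hier lam k1 k2)).2 rfl, fun j => ⟨(hm j).isDiffFun,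
    ext (hierPotential lam k1 k2 j).1, ?_, fun a ha h => ?_, ?_⟩⟩
  · exact isPotential_hierPotential lam k1 k2 hlam (hm j) (agrees_ext _)
  · rw [ext_apply _ ha]
    exact hierPotential_apply_of_isConst lam k1 k2 j (a := ⟨a, ha⟩) h
  · exact ((hm (j + 1)).congr_iff (agrees_R_hier lam k1 k2 hlam (hm j) (agrees_ext _))).2 rfl

/-- Two antiderivatives of Λ Q_j differ by an element of the kernel of D. The normalization makes it
vanish at jets with constant Schwarzian, hence everywhere. -/
theorem IsHierarchy.agrees (hlam : lam ≠ 0) {Q : ℕ → Jet → ℝ} (hQ : IsHierarchy lam k1 k2 Q)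
    (j : ℕ) : Agrees (Q j) (coordU 1 * hier lam k1 k2 j) := by
  induction j with
  | zero => exact fun a ha => (hQ.1 a ha).trans (agrees_K_hier lam k1 k2 a ha)
  | succ j ih =>
    obtain ⟨-, P, hP, hP0, hR⟩ := hQ.2 j
    obtain ⟨p, hp⟩ := hP.1.exists_agrees
    have hpot := isPotential_hierPotential lam k1 k2 hlam ih (agrees_ext _)
    have hD : D (p - hierPotential lam k1 k2 j) = 0 := by
      rw [map_sub, sub_eq_zero]
      refine (hp.dx.congr_iff (agrees_ext (hierPotential lam k1 k2 j)).dx).1 fun a ha => ?_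
      rw [hP.2 a ha, hpot.2 a ha]
    have h0 : p - hierPotential lam k1 k2 j = 0 := eq_zero_of_D_eq_zero hD fun a ha => by
      rw [val_sub, hierPotential_apply_of_isConst lam k1 k2 j ha, sub_zero, ← hp a a.2]
      exact hP0 a a.2 ha
    rw [sub_eq_zero] at h0
    rw [h0] at hp
    exact fun a ha => (hR a ha).trans (agrees_R_hier lam k1 k2 hlam ih hp a ha)

/-! ### Orders of the members -/

lemma du_of_mem {n k : ℕ} {α : DiffFun} (h : α ∈ SchFun n) (hk : n + 3 < k) : du k α = 0 :=
  du_eq_zero (agrees_ext α) (hasOrderLE_of_mem h).1 (by omega)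

lemma du_three_sch : du 3 sch = invUx := by
  have h1 : du 3 (coordU 3) = 1 := by rw [du_coordU, Pi.single_eq_same]
  have h2 : du 3 (coordU 2) = 0 := by rw [du_coordU, Pi.single_eq_of_ne (by norm_num)]
  have h3 : du 3 (coordU 1) = 0 := by rw [du_coordU, Pi.single_eq_of_ne (by norm_num)]
  have h4 : du 3 invUx = 0 := by rw [derivation_invUx, h3, mul_zero]
  simp [sch, Derivation.leibniz, Derivation.leibniz_pow, h1, h2, h4]

lemma two_mul_du_three_rs : 2 * du 3 rs = -(rs ^ 3 * invUx) := by
  have h := congrArg (du 3) rs_mul_rs_mul_sch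
  simp only [Derivation.leibniz, smul_eq_mul, Derivation.map_one_eq_zero, du_three_sch] at h
  linear_combination rs * h - 2 * du 3 rs * rs_mul_rs_mul_sch

lemma isUnit_invUx : IsUnit invUx :=
  IsUnit.of_mul_eq_one (coordU 1) (by rw [mul_comm]; exact coordU_mul_invUx)

/-- Comparing top-order derivatives in J g = -k2 f''' gives 2 S ∂g/∂u_{(2j+5)x} = -k2
∂f/∂u_{(2j+3)x}, so invertibility propagates from r. -/
lemma isUnit_du_hier (hlam : lam ≠ 0) (hk2 : k2 ≠ 0) (j : ℕ) :
    IsUnit (du (2 * j + 3) (hier lam k1 k2 j)) := by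
  have hreal : ∀ r : ℝ, r ≠ 0 → IsUnit (algebraMap ℝ DiffFun r) := fun r hr =>
    (isUnit_iff_ne_zero.2 hr).map _
  induction j with
  | zero =>
    rw [hier_zero, Derivation.map_smul, Algebra.smul_def]
    refine (hreal lam hlam).mul ?_
    have h : IsUnit (2 * du 3 rs) := by
      rw [two_mul_du_three_rs]
      exact ((isUnit_rs.pow 3).mul isUnit_invUx).neg
    exact isUnit_of_mul_isUnit_right h
  | succ j ih =>
    have hA := hier_mem_SchFun lam k1 k2 j
    have hT := hierTail_mem_SchFun lam k1 k2 j
    have h1 : du (2 * (j + 1) + 3) (hier lam k1 k2 (j + 1)) =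
        du (2 * j + 5) (hierTail lam k1 k2 j) := by
      rw [hier_succ, map_add, Derivation.map_smul, show 2 * (j + 1) + 3 = 2 * j + 5 by ring,
        show du (2 * j + 5) (hier lam k1 k2 j) = 0 from du_of_mem hA (by omega), smul_zero,
        zero_add]
    -- The index 2j + 6 is one above the order bound of g and three above that of f, so only the
    -- highest total derivative on each side contributes.
    have h2 := congrArg (du (2 * j + 6)) (J2_hierTail lam k1 k2 j)
    simp only [J2, map_add, Derivation.leibniz, smul_eq_mul, derivation_two] at h2
    have e1 : du (2 * j + 6) (hierTail lam k1 k2 j) = 0 := du_of_mem hT (by omega)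
    have e2 : du (2 * j + 6) sch = 0 := du_of_mem sch_mem (by omega)
    have e3 : du (2 * j + 6) (D sch) = 0 := du_of_mem (D_mem_SchFun sch_mem) (by omega)
    have e4 : du (2 * j + 6) (D (D (hier lam k1 k2 j))) = 0 :=
      du_of_mem (D_mem_SchFun (D_mem_SchFun hA)) (by omega)
    have e5 : du (2 * j + 5) (D (hier lam k1 k2 j)) = 0 :=
      du_of_mem (D_mem_SchFun hA) (by omega)
    have e6 : du (2 * j + 4) (hier lam k1 k2 j) = 0 := du_of_mem hA (by omega)
    have g1 : du (2 * j + 6) (D (hierTail lam k1 k2 j)) = du (2 * j + 5) (hierTail lam k1 k2 j) := by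
      rw [du_succ_D, e1, map_zero, zero_add]
    have g2 : du (2 * j + 6) (D (D (D (hier lam k1 k2 j)))) = du (2 * j + 3) (hier lam k1 k2 j) := by
      rw [du_succ_D, e4, map_zero, zero_add, du_succ_D, e5, map_zero, zero_add, du_succ_D, e6,
        map_zero, zero_add]
    rw [Derivation.map_smul, g1, g2, e1, e2, e3] at h2
    simp only [mul_zero, add_zero] at h2
    rw [h1]
    have h3 : IsUnit (2 * sch * du (2 * j + 5) (hierTail lam k1 k2 j)) := by
      rw [h2, Algebra.smul_def]
      exact (hreal _ (neg_ne_zero.2 hk2)).mul ih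
    exact isUnit_of_mul_isUnit_right h3

lemma hasOrder_member (hlam : lam ≠ 0) (hk2 : k2 ≠ 0) (j : ℕ) :
    HasOrder (2 * j + 3) (member lam k1 k2 j) := by
  refine ⟨(hasOrderLE_of_mem (hier_mem_SchFun lam k1 k2 j)).2, fun a ha h => ?_⟩
  rw [(agrees_member lam k1 k2 j).partialU _ a ha, Derivation.leibniz, du_coordU,
    Pi.single_eq_of_ne (by omega), smul_zero, add_zero, smul_eq_mul, val_mul] at h
  obtain ⟨v, hv⟩ := (isUnit_du_hier lam k1 k2 hlam hk2 j).exists_right_inv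
  have h1 := congrArg (fun α : DiffFun => α.1 ⟨a, ha⟩) hv
  have h2 : (du (2 * j + 3) (hier lam k1 k2 j)).1 ⟨a, ha⟩ * v.1 ⟨a, ha⟩ = 1 := h1
  rcases mul_eq_zero.1 h with h | h
  · exact ha.1 h
  · rw [h, zero_mul] at h2
    exact zero_ne_one h2

/-! ### The members of orders five and seven -/

lemma rs_sq_mul_S (a : dom) : rs.1 a * rs.1 a * sch.1 a = 1 :=
  congrArg (fun α : DiffFun => α.1 a) rs_mul_rs_mul_sch

lemma dym_one : dym 1 = (5 / 16 : ℝ) • (rs ^ 7 * D sch ^ 2) - (1 / 4 : ℝ) • (rs ^ 5 * D (D sch)) := by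
  rw [dym_succ]
  simp only [Fin.sum_univ_succ, Fin.sum_univ_zero, Fin.val_zero, dym_zero, Nat.sub_zero, add_zero,
    mul_zero, sub_zero]
  rw [D_D_rs, D_rs, two_mul]
  refine Subtype.ext (funext fun a => ?_)
  simp only [val_mul, val_add, val_sub, val_smul, val_pow]
  ring

lemma D_dym_one : D (dym 1) = (5 / 4 : ℝ) • (rs ^ 7 * D sch * D (D sch)) -
    (1 / 4 : ℝ) • (rs ^ 5 * D (D (D sch))) - (35 / 32 : ℝ) • (rs ^ 9 * D sch ^ 3) := by
  rw [dym_one]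
  simp only [map_sub, Derivation.map_smul, Derivation.leibniz, Derivation.leibniz_pow, D_rs]
  refine Subtype.ext (funext fun a => ?_)
  simp only [val_mul, val_add, val_sub, val_smul, val_pow, val_nsmul, smul_eq_mul, Nat.cast_ofNat]
  ring

lemma D_D_dym_one : D (D (dym 1)) = (5 / 4 : ℝ) • (rs ^ 7 * D (D sch) ^ 2) +
    (15 / 8 : ℝ) • (rs ^ 7 * D sch * D (D (D sch))) -
    (245 / 32 : ℝ) • (rs ^ 9 * D sch ^ 2 * D (D sch)) -
    (1 / 4 : ℝ) • (rs ^ 5 * D (D (D (D sch)))) + (315 / 64 : ℝ) • (rs ^ 11 * D sch ^ 4) := by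
  rw [D_dym_one]
  simp only [map_sub, Derivation.map_smul, Derivation.leibniz, Derivation.leibniz_pow, D_rs]
  refine Subtype.ext (funext fun a => ?_)
  simp only [val_mul, val_add, val_sub, val_smul, val_pow, val_nsmul, smul_eq_mul, Nat.cast_ofNat]
  ring

lemma dym_two_apply (a : dom) : (dym 2).1 a =
    1 / 16 * (-2 * rs.1 a ^ 7 * (D (D (D (D sch)))).1 a +
      14 * rs.1 a ^ 9 * (D sch).1 a * (D (D (D sch))).1 a +
      21 / 2 * rs.1 a ^ 9 * (D (D sch)).1 a ^ 2 -
      231 / 4 * rs.1 a ^ 11 * (D sch).1 a ^ 2 * (D (D sch)).1 a +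
      1155 / 32 * rs.1 a ^ 13 * (D sch).1 a ^ 4) := by
  have hS := rs_sq_mul_S a
  rw [dym_succ]
  simp only [Fin.sum_univ_succ, Fin.sum_univ_zero, Fin.val_zero, Fin.val_succ, dym_zero,
    Nat.sub_zero, add_zero, zero_add, Nat.sub_self]
  rw [D_D_dym_one, D_dym_one, dym_one, D_D_rs, D_rs, mul_assoc 2, mul_assoc 2, mul_assoc 2, two_mul,
    two_mul, two_mul]
  simp only [val_mul, val_add, val_sub, val_smul, val_pow]
  -- The b_1² term of the recursion carries an explicit factor S, removed here by r² S = 1.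
  linear_combination (-(1 / 2) * rs.1 a ^ 9 *
    (5 / 16 * rs.1 a ^ 2 * (D sch).1 a ^ 2 - 1 / 4 * (D (D sch)).1 a) ^ 2) * hS

end

end SchwarzianFlow

end

theorem proposition1 (lam k1 k2 : ℝ) (hlam : lam ≠ 0) (hk2 : k2 ≠ 0) :
    -- `R[u]` is a recursion operator of `u_t = λ u_x S^{-1/2}`
    SchwarzianFlow.IsRecursionOperator lam k1 k2 (SchwarzianFlow.K lam) ∧
    -- the hierarchy `u_{t_j} = R^j[u] u_t` exists and is unique
    ∃ Q : ℕ → SchwarzianFlow.Jet → ℝ,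
      SchwarzianFlow.IsHierarchy lam k1 k2 Q ∧
      (∀ Q' : ℕ → SchwarzianFlow.Jet → ℝ, SchwarzianFlow.IsHierarchy lam k1 k2 Q' →
        ∀ j, ∀ a ∈ SchwarzianFlow.dom, Q' j a = Q j a) ∧
      -- the members have the orders `3, 5, 7, ...`
      (∀ j, SchwarzianFlow.HasOrder (2 * j + 3) (Q j)) ∧
      -- every member is symmetry-integrable: all members are symmetries of each of them, and `R[u]`
      -- is a recursion operator of each of them
      (∀ i j, SchwarzianFlow.IsSymmetry (Q i) (Q j)) ∧
      (∀ j, SchwarzianFlow.IsRecursionOperator lam k1 k2 (Q j)) ∧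
      -- every member has the form `u_x Ψ_j(S, S_x, ..., S_{nx})`, with `n = 2 j`
      (∀ j, ∃ Ψ : (Fin (2 * j + 1) → ℝ) → ℝ,
        ContDiffOn ℝ ∞ Ψ {s | 0 < s 0} ∧
        ∀ a ∈ SchwarzianFlow.dom, Q j a = a.u 1 * Ψ (fun i => SchwarzianFlow.Sx i a)) ∧
      -- the member of order five
      (∀ a ∈ SchwarzianFlow.dom, Q 1 a = lam * a.u 1 *
        (k2 / 4 * (SchwarzianFlow.Sx 2 a / √(SchwarzianFlow.S a) ^ 5)
          - 5 * k2 / 16 * (SchwarzianFlow.Sx 1 a ^ 2 / √(SchwarzianFlow.S a) ^ 7)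
          + (k2 / 2 + k1) * (1 / √(SchwarzianFlow.S a)))) ∧
      -- the member of order seven
      (k2 = 1 → ∀ a ∈ SchwarzianFlow.dom, Q 2 a = lam * a.u 1 *
        (-(1 / 8) * (SchwarzianFlow.Sx 4 a / √(SchwarzianFlow.S a) ^ 7)
          + 7 / 8 * (SchwarzianFlow.Sx 1 a * SchwarzianFlow.Sx 3 a / √(SchwarzianFlow.S a) ^ 9)
          + 21 / 32 * (SchwarzianFlow.Sx 2 a ^ 2 / √(SchwarzianFlow.S a) ^ 9)
          - 231 / 64 * (SchwarzianFlow.Sx 1 a ^ 2 * SchwarzianFlow.Sx 2 a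
              / √(SchwarzianFlow.S a) ^ 11)
          + 1 / 4 * (2 * k1 + 1) * (SchwarzianFlow.Sx 2 a / √(SchwarzianFlow.S a) ^ 5)
          + 1155 / 512 * (SchwarzianFlow.Sx 1 a ^ 4 / √(SchwarzianFlow.S a) ^ 13)
          - 5 / 16 * (2 * k1 + 1) * (SchwarzianFlow.Sx 1 a ^ 2 / √(SchwarzianFlow.S a) ^ 7)
          + 1 / 4 * (2 * k1 + 1) ^ 2 * (1 / √(SchwarzianFlow.S a)))) := by
  open SchwarzianFlow in
  have hm := agrees_member lam k1 k2
  have hb := hier_mem lam k1 k2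
  refine ⟨isRecursionOperator_of_mem lam k1 k2 hlam hk2 (hb 0) (agrees_K_hier lam k1 k2),
    member lam k1 k2, isHierarchy_member lam k1 k2 hlam, fun Q' hQ' j =>
      ((hQ'.agrees lam k1 k2 hlam j).congr_iff (hm j)).2 rfl,
    hasOrder_member lam k1 k2 hlam hk2, fun i j => isSymmetry_of_mem (hb i) (hb j) (hm i) (hm j),
    fun j => isRecursionOperator_of_mem lam k1 k2 hlam hk2 (hb j) (hm j), fun j => ?_, ?_, ?_⟩
  · obtain ⟨Ψ, hΨ, h⟩ := hier_mem_SchFun lam k1 k2 j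
    refine ⟨Ψ, hΨ, fun a ha => ?_⟩
    rw [hm j a ha, val_mul, h]
    rfl
  · intro a ha
    have h1 : hierPoly lam k1 k2 1 = Polynomial.monomial 0 (lam * (k1 + k2 / 2)) +
        Polynomial.monomial 1 (-(lam * k2)) := by
      rw [hierPoly, ← Polynomial.C_mul_X_pow_eq_monomial, ← Polynomial.C_mul_X_pow_eq_monomial]
      simp only [Polynomial.C_mul, Polynomial.C_neg]
      ring
    rw [hm 1 a ha, hier, h1, map_add, dymPoly_monomial, dymPoly_monomial, dym_zero, dym_one,
      Sx_eq 1 ha, Sx_eq 2 ha]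
    simp only [val_mul, val_add, val_sub, val_smul, val_pow, val_coordU, rs_apply,
      Function.iterate_succ, Function.iterate_zero, Function.comp, id]
    ring
  · rintro rfl a ha
    -- This is λ (c - X)² with c = k1 + 1/2, whose middle coefficient is -2λc = -λ(2 k1 + 1).
    have h1 : hierPoly lam k1 1 2 = Polynomial.monomial 0 (lam * (k1 + 1 / 2) ^ 2) +
        Polynomial.monomial 1 (-(lam * (2 * k1 + 1))) + Polynomial.monomial 2 lam := by
      rw [hierPoly, ← Polynomial.C_mul_X_pow_eq_monomial, ← Polynomial.C_mul_X_pow_eq_monomial,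
        ← Polynomial.C_mul_X_pow_eq_monomial, show 2 * k1 + 1 = 2 * (k1 + 1 / 2) by ring]
      simp only [Polynomial.C_mul, Polynomial.C_neg, Polynomial.C_pow, Polynomial.C_1,
        Polynomial.C_ofNat]
      ring
    rw [hm 2 a ha, hier, h1, map_add, map_add, dymPoly_monomial, dymPoly_monomial,
      dymPoly_monomial, dym_zero, dym_one, Sx_eq 1 ha, Sx_eq 2 ha, Sx_eq 3 ha, Sx_eq 4 ha]
    simp only [val_mul, val_add, val_sub, val_smul, val_pow, val_coordU, dym_two_apply, rs_apply,
      Function.iterate_succ, Function.iterate_zero, Function.comp, id]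
    ring
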